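/- Let $\Gamma(\mathbb C^n)$ be the $n$-mode boson Fock space, identified through its particle basis $\{|\mathbf k\rangle:\mathbf k\in\mathbb Z_+^n\}$ with $\ell^2(\mathbb Z_+^n)$, with exponential vectors $e(\mathbf z)=\sum_{\mathbf k}\frac{\mathbf z^{\mathbf k}}{\sqrt{\mathbf k!}}|\mathbf k\rangle$ and coherent states $\psi(\mathbf z)=e^{-\|\mathbf z\|^2/2}e(\mathbf z)$, and let $W(\mathbf u)$ be the Weyl operator, i.e. the unitary operator with $W(\mathbf u)\psi(\mathbf z)=e^{-i\,\mathrm{Im}\langle\mathbf u|\mathbf z\rangle}\psi(\mathbf u+\mathbf z)$ for all $\mathbf z$ (inner products are conjugate linear in the first variable). Write $[\mathbf z]=\begin{bmatrix}\mathrm{Re}\,\mathbf z\\ \mathrm{Im}\,\mathbf z\end{bmatrix}\in\mathbb R^{2n}$ for $\mathbf z\in\mathbb C^n$. A state $\rho$ (a positive operator of trace one) on $\Gamma(\mathbb C^n)$ is the gaussian state $\rho_{\mathbf m,S}$ with mean $\mathbf m\in\mathbb C^n$ and covariance matrix $S$ (a real symmetric $2n\times 2n$ matrix) if $\operatorname{tr}\rho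 W(\mathbf z)=\exp\{-2i\,\mathrm{Im}\langle\mathbf z|\mathbf m\rangle-[\mathbf z]^TS[\mathbf z]\}$ for all $\mathbf z\in\mathbb C^n$. A quadruple $(c,\boldsymbol\mu,A,\Lambda)$ with $c\in\mathbb C$, $\boldsymbol\mu\in\mathbb C^n$, $A,\Lambda\in M_n(\mathbb C)$, $A$ symmetric, is the quadruple of $\mathcal E_2$-parameters of $\rho$ if, for all $\mathbf u,\mathbf v\in\mathbb C^n$, $$\langle e(\bar{\mathbf u})|\rho|e(\mathbf v)\rangle=c\exp\{\mathbf u^T\boldsymbol\mu+\bar{\boldsymbol\mu}^T\mathbf v+\mathbf u^TA\mathbf u+\mathbf u^T\Lambda\mathbf v+\mathbf v^T\bar A\mathbf v\}.$$ Put $J=\begin{bmatrix}0&I\\-I&0\end{bmatrix}$ and $$M(A,\Lambda)=I-\begin{bmatrix}\mathrm{Re}\,\Lambda&-\mathrm{Im}\,\Lambda\\ \mathrm{Im}\,\Lambda&\mathrm{Re}\,\Lambda\end{bmatrix}-2\begin{bmatrix}\mathrm{Re}\,A&\mathrm{Im}\,A\\ \mathrm{Im}\,A&-\mathrm{Re}\,A\end{bmatrix},$$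 and let $C$ denote complex conjugation on $\mathbb C^n$. Let $\rho=\rho_{\mathbf m,S}$ be a gaussian state. Then $\tfrac12I+S$ is strictly positive, $\rho$ has $\mathcal E_2$-parameters $(c,\boldsymbol\mu,A,\Lambda)$, and any such quadruple satisfies the following (so it is unique). (a) $\Lambda\ge 0$ and $$c=\det(\tfrac12I+S)^{-1/2}\exp\{[\mathbf m]^TJ(\tfrac12I+S)^{-1}J[\mathbf m]\},\qquad \boldsymbol\mu=i\begin{bmatrix}I&iI\end{bmatrix}(\tfrac12I+S)^{-1}J[\mathbf m],$$ $$A=\tfrac14\begin{bmatrix}I&iI\end{bmatrix}(\tfrac12I+S)^{-1}\begin{bmatrix}I\\iI\end{bmatrix},\qquad \Lambda=I-\tfrac12\begin{bmatrix}I&iI\end{bmatrix}(\tfrac12I+S)^{-1}\begin{bmatrix}I\\-iI\end{bmatrix}.$$ (b) $(\tfrac12I+S)^{-1}=M(-A,\Lambda)$. (c) $(I-\Lambda-2AC)\mathbf m=\boldsymbol\mu$; moreover $M(A,\Lambda)$ is invertible and $[\mathbf m]=M(A,\Lambda)^{-1}[\boldsymbol\mu]$. In particular, $\boldsymbol\mu=0$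 if and only if $\mathbf m=0$. -/

import Mathlib

noncomputable section

namespace BosonFock

/-! ### Facts on power series in several variables, needed for the definitions below -/

theorem hasSum_pi_prod : ∀ {n : ℕ} (f : Fin n → ℕ → ℂ), (∀ j, Summable fun i => ‖f j i‖) →
    (Summable fun k : Fin n → ℕ => ‖∏ j, f j (k j)‖) ∧
      HasSum (fun k : Fin n → ℕ => ∏ j, f j (k j)) (∏ j, ∑' i, f j i) := by
  intro n
  induction n with
  | zero =>
    intro f _
    refine ⟨(hasSum_unique _).summable, ?_⟩
    simp
  | succ n ih =>
    intro f hf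
    obtain ⟨h1, h2⟩ := ih (fun j => f j.succ) (fun j => hf j.succ)
    obtain ⟨e, he⟩ : ∃ e : ℕ × (Fin n → ℕ) ≃ (Fin (n + 1) → ℕ), ∀ p, e p = Fin.cons p.1 p.2 :=
      ⟨Fin.consEquiv (fun _ : Fin (n + 1) => ℕ), fun _ => rfl⟩
    obtain ⟨g, hg⟩ : ∃ g : (Fin n → ℕ) → ℂ, g = fun k => ∏ j, f j.succ (k j) := ⟨_, rfl⟩
    have key : ∀ p : ℕ × (Fin n → ℕ), (∏ j, f j (e p j)) = f 0 p.1 * g p.2 := by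
      intro p
      rw [Fin.prod_univ_succ]
      simp [he, hg]
    rw [← hg] at h2
    have h1' : Summable fun k => ‖g k‖ := by
      rw [hg]
      exact h1
    have hs : Summable fun p : ℕ × (Fin n → ℕ) => ‖f 0 p.1 * g p.2‖ := (hf 0).mul_norm h1'
    constructor
    · refine e.summable_iff.mp (hs.congr fun p => ?_)
      simp only [Function.comp_apply, key]
    · rw [← e.hasSum_iff, Fin.prod_univ_succ]
      rw [show ((fun k : Fin (n + 1) → ℕ => ∏ j, f j (k j)) ∘ e) =
        fun p : ℕ × (Fin n → ℕ) => f 0 p.1 * g p.2 from funext key]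
      exact (hf 0).of_norm.hasSum.mul h2 hs.of_norm

theorem coeff_eq_zero_one (b : ℕ → ℂ) (h : ∀ z : ℂ, HasSum (fun i => z ^ i * b i) 0) :
    ∀ i, b i = 0 := by
  have hp : HasFPowerSeriesAt (0 : ℂ → ℂ) (FormalMultilinearSeries.ofScalars ℂ b) 0 := by
    rw [hasFPowerSeriesAt_iff]
    refine Filter.Eventually.of_forall fun z => ?_
    simpa using h z
  intro i
  have h2 : (FormalMultilinearSeries.ofScalars ℂ b : FormalMultilinearSeries ℂ ℂ ℂ).coeff i
      = (0 : FormalMultilinearSeries ℂ ℂ ℂ).coeff i := by rw [hp.eq_zero]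
  rw [FormalMultilinearSeries.coeff_ofScalars] at h2
  rw [h2]
  rfl

theorem coeff_eq_zero : ∀ {n : ℕ} (a : (Fin n → ℕ) → ℂ),
    (∀ z : Fin n → ℂ, HasSum (fun k => (∏ j, z j ^ k j) * a k) 0) → ∀ k, a k = 0 := by
  intro n
  induction n with
  | zero =>
    intro a h k
    have h1 := h 0
    have h2 := hasSum_unique (fun k : Fin 0 → ℕ => (∏ j, (0 : Fin 0 → ℂ) j ^ k j) * a k)
    have := h1.unique h2
    rw [Finset.univ_eq_empty, Finset.prod_empty, one_mul] at this
    exact (congrArg a (Subsingleton.elim _ _)).trans this.symm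
  | succ n ih =>
    intro a h
    let e := Fin.consEquiv (fun _ : Fin (n + 1) => ℕ)
    have h' : ∀ (w : ℂ) (z : Fin n → ℂ), HasSum
        (fun p : ℕ × (Fin n → ℕ) => w ^ p.1 * ((∏ j, z j ^ p.2 j) * a (e p))) 0 := by
      intro w z
      have h1 := e.hasSum_iff.mpr (h (Fin.cons w z))
      have h2 : ((fun k : Fin (n + 1) → ℕ =>
          (∏ j, (Fin.cons w z : Fin (n + 1) → ℂ) j ^ k j) * a k) ∘ e) =
          fun p : ℕ × (Fin n → ℕ) => w ^ p.1 * ((∏ j, z j ^ p.2 j) * a (e p)) := by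
        funext p
        simp only [Function.comp_apply]
        rw [Fin.prod_univ_succ]
        simp [e, Fin.consEquiv, mul_assoc]
      rwa [h2] at h1
    have hsum : ∀ (z : Fin n → ℂ) (i : ℕ),
        Summable fun k : Fin n → ℕ => (∏ j, z j ^ k j) * a (e (i, k)) := by
      intro z i
      have := (h' 1 z).summable.prod_factor i
      simpa using this
    have hzero : ∀ (z : Fin n → ℂ) (i : ℕ),
        (∑' k : Fin n → ℕ, (∏ j, z j ^ k j) * a (e (i, k))) = 0 := by
      intro z
      refine coeff_eq_zero_one _ fun w => ?_
      exact (h' w z).prod_fiberwise fun i => (hsum z i).hasSum.mul_left (w ^ i)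
    intro k
    have := ih (fun k' => a (e (k 0, k'))) (fun z => by
      have := (hsum z (k 0)).hasSum
      rwa [hzero] at this) (Fin.tail k)
    simpa [e, Fin.consEquiv] using this

/-! ### Fock space, exponential vectors, coherent states -/

/-- The `n`-mode boson Fock space over `ℂⁿ` in its particle (occupation number) representation:
the Hilbert space `ℓ²(ℕⁿ)`, the particle basis vector `|k⟩` being the unit sequence at `k`. -/
abbrev Fock (n : ℕ) : Type := lp (fun _ : Fin n → ℕ => ℂ) 2

/-- The particle basis vector `|k⟩`. -/
def particle {n : ℕ} (k : Fin n → ℕ) : Fock n := lp.single 2 k 1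

/-- The coefficients `zᵏ / √(k!)` of the exponential vector in the particle basis. -/
def expCoeff {n : ℕ} (z : Fin n → ℂ) (k : Fin n → ℕ) : ℂ :=
  ∏ j, z j ^ k j / (Real.sqrt ((k j).factorial : ℝ) : ℂ)

theorem expCoeff_mul {n : ℕ} (z w : Fin n → ℂ) (k : Fin n → ℕ) :
    star (expCoeff z k) * expCoeff w k =
      ∏ j, (fun i : ℕ => (star (z j) * w j) ^ i / (i.factorial : ℂ)) (k j) := by
  have hs : ∀ i : ℕ, ((Real.sqrt (i.factorial : ℝ) : ℝ) : ℂ) * (Real.sqrt (i.factorial : ℝ) : ℝ)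
      = (i.factorial : ℂ) := by
    intro i
    rw [← Complex.ofReal_mul, Real.mul_self_sqrt (Nat.cast_nonneg _)]
    simp
  simp only [expCoeff, star_prod, ← Finset.prod_mul_distrib]
  refine Finset.prod_congr rfl fun j _ => ?_
  rw [← hs (k j), mul_pow]
  simp only [Complex.star_def, map_div₀, map_pow, Complex.conj_ofReal]
  rw [div_mul_div_comm]

theorem star_inner_symm {n : ℕ} (x y : Fin n → ℂ) : star (star x ⬝ᵥ y) = star y ⬝ᵥ x := by
  simp [dotProduct, mul_comm]

theorem summable_exp (x : ℂ) : Summable fun i : ℕ => ‖x ^ i / (i.factorial : ℂ)‖ :=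
  NormedSpace.norm_expSeries_div_summable x

theorem hasSum_expCoeff {n : ℕ} (z w : Fin n → ℂ) :
    (Summable fun k => ‖star (expCoeff z k) * expCoeff w k‖) ∧
      HasSum (fun k => star (expCoeff z k) * expCoeff w k) (Complex.exp (star z ⬝ᵥ w)) := by
  have h := hasSum_pi_prod (fun (j : Fin n) (i : ℕ) => (star (z j) * w j) ^ i / (i.factorial : ℂ))
    (fun j => summable_exp _)
  have e : ∀ j, (∑' i : ℕ, (star (z j) * w j) ^ i / (i.factorial : ℂ))
      = Complex.exp (star (z j) * w j) := by
    intro j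
    rw [Complex.exp_eq_exp_ℂ, NormedSpace.exp_eq_tsum_div]
  simp only [e, ← Complex.exp_sum] at h
  simp only [expCoeff_mul]
  exact h

theorem memlp_expCoeff {n : ℕ} (z : Fin n → ℂ) : Memℓp (expCoeff z) 2 := by
  refine memℓp_gen ?_
  refine (hasSum_expCoeff z z).1.congr fun k => ?_
  rw [norm_mul, norm_star]
  simp [sq]

/-- The exponential vector `e(z) = ∑ₖ zᵏ / √(k!) |k⟩`. -/
def expVec {n : ℕ} (z : Fin n → ℂ) : Fock n := ⟨expCoeff z, memlp_expCoeff z⟩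

theorem inner_expVec {n : ℕ} (z w : Fin n → ℂ) :
    inner ℂ (expVec z) (expVec w) = Complex.exp (star z ⬝ᵥ w) := by
  have h1 := lp.hasSum_inner (𝕜 := ℂ) (expVec z) (expVec w)
  have h2 : (fun k => inner ℂ (expVec z k) (expVec w k)) =
      fun k => star (expCoeff z k) * expCoeff w k := by
    funext k
    simp [expVec, mul_comm]
  rw [h2] at h1
  exact h1.unique (hasSum_expCoeff z w).2

/-- The coherent state `ψ(z) = exp(-‖z‖²/2) e(z)`. -/
def coherent {n : ℕ} (z : Fin n → ℂ) : Fock n :=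
  Complex.exp (-(star z ⬝ᵥ z) / 2) • expVec z

theorem inner_coherent {n : ℕ} (z w : Fin n → ℂ) :
    inner ℂ (coherent z) (coherent w) =
      Complex.exp (star z ⬝ᵥ w - (star z ⬝ᵥ z) / 2 - (star w ⬝ᵥ w) / 2) := by
  have hz : (starRingEnd ℂ) (star z ⬝ᵥ z) = star z ⬝ᵥ z := by
    change star (star z ⬝ᵥ z) = _
    exact star_inner_symm z z
  simp only [coherent, inner_smul_left, inner_smul_right, inner_expVec, ← Complex.exp_conj,
    ← Complex.exp_add, map_div₀, map_neg, hz]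
  congr 1
  simp only [map_ofNat]
  ring

theorem denseRange_coherent (n : ℕ) :
    DenseRange (Finsupp.linearCombination ℂ (coherent (n := n))) := by
  have : Dense ((LinearMap.range (Finsupp.linearCombination ℂ (coherent (n := n))) :
      Submodule ℂ (Fock n)) : Set (Fock n)) := by
    rw [Submodule.dense_iff_topologicalClosure_eq_top, Submodule.topologicalClosure_eq_top_iff,
      Submodule.eq_bot_iff]
    intro φ hφ
    rw [Submodule.mem_orthogonal] at hφ
    have h0 : ∀ z : Fin n → ℂ, inner ℂ (expVec z) φ = 0 := by
      intro z
      have := hφ (coherent z) ⟨Finsupp.single z 1, by simp⟩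
      rw [coherent, inner_smul_left] at this
      rcases mul_eq_zero.mp this with h | h
      · rw [← Complex.exp_conj] at h
        exact absurd h (Complex.exp_ne_zero _)
      · exact h
    have hc : ∀ k : Fin n → ℕ, φ k / ∏ j, (Real.sqrt ((k j).factorial : ℝ) : ℂ) = 0 := by
      refine coeff_eq_zero _ fun z => ?_
      have := lp.hasSum_inner (𝕜 := ℂ) (expVec (star z)) φ
      rw [h0] at this
      have h2 : (fun k => inner ℂ (expVec (star z) k) (φ k)) = fun k => (∏ j, z j ^ k j) *
          (φ k / ∏ j, (Real.sqrt ((k j).factorial : ℝ) : ℂ)) := by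
        funext k
        simp [expVec, expCoeff, Finset.prod_div_distrib]
        ring
      rw [h2] at this
      exact this
    ext k
    have h := hc k
    rw [div_eq_zero_iff] at h
    rcases h with h | h
    · simpa using h
    · exfalso
      rw [Finset.prod_eq_zero_iff] at h
      obtain ⟨j, _, hj⟩ := h
      have : Real.sqrt ((k j).factorial : ℝ) ≠ 0 :=
        (Real.sqrt_pos.mpr (by exact_mod_cast Nat.factorial_pos _)).ne'
      exact this (Complex.ofReal_eq_zero.mp hj)
  exact this

/-! ### Weyl operators -/

/-- The vector `exp(-i Im ⟨u, z⟩) ψ(u + z)`. -/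
def displaced {n : ℕ} (u z : Fin n → ℂ) : Fock n :=
  Complex.exp (-Complex.I * ((star u ⬝ᵥ z).im : ℂ)) • coherent (u + z)

theorem inner_displaced {n : ℕ} (u z w : Fin n → ℂ) :
    inner ℂ (displaced u z) (displaced u w) = inner ℂ (coherent z) (coherent w) := by
  simp only [displaced, inner_smul_left, inner_smul_right, inner_coherent, ← Complex.exp_conj,
    ← Complex.exp_add]
  congr 1
  have hI : ∀ x : ℂ, Complex.I * (x.im : ℂ) = (x - star x) / 2 := by
    intro x
    apply Complex.ext <;> simp
  have hc : ∀ x y : Fin n → ℂ, (starRingEnd ℂ) (star x ⬝ᵥ y) = star y ⬝ᵥ x := star_inner_symm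
  simp only [neg_mul, hI, star_inner_symm, star_add, add_dotProduct, dotProduct_add,
    map_neg, map_div₀, map_sub, map_ofNat, hc]
  ring

theorem linearCombination_norm_eq {n : ℕ} {ι : Type} (f g : ι → Fock n)
    (h : ∀ i j, inner ℂ (f i) (f j) = inner ℂ (g i) (g j)) (x : ι →₀ ℂ) :
    ‖Finsupp.linearCombination ℂ f x‖ = ‖Finsupp.linearCombination ℂ g x‖ := by
  have key : inner ℂ (Finsupp.linearCombination ℂ f x) (Finsupp.linearCombination ℂ f x) =
      inner ℂ (Finsupp.linearCombination ℂ g x) (Finsupp.linearCombination ℂ g x) := by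
    simp only [Finsupp.linearCombination_apply, Finsupp.sum, sum_inner, inner_sum,
      inner_smul_left, inner_smul_right, h]
  rw [inner_self_eq_norm_sq_to_K, inner_self_eq_norm_sq_to_K] at key
  have : ‖Finsupp.linearCombination ℂ f x‖ ^ 2 = ‖Finsupp.linearCombination ℂ g x‖ ^ 2 := by
    exact_mod_cast key
  exact (sq_eq_sq₀ (norm_nonneg _) (norm_nonneg _)).mp this

theorem denseRange_displaced {n : ℕ} (u : Fin n → ℂ) :
    DenseRange (Finsupp.linearCombination ℂ (displaced u)) := by
  refine (denseRange_coherent n).mono ?_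
  have : Submodule.span ℂ (Set.range (coherent (n := n))) ≤
      Submodule.span ℂ (Set.range (displaced u)) := by
    rw [Submodule.span_le]
    rintro _ ⟨z, rfl⟩
    have h : coherent z = (Complex.exp (-Complex.I * ((star u ⬝ᵥ (z - u)).im : ℂ)))⁻¹ •
        displaced u (z - u) := by
      rw [displaced, smul_smul, inv_mul_cancel₀ (Complex.exp_ne_zero _)]
      simp
    rw [h]
    exact Submodule.smul_mem _ _ (Submodule.subset_span ⟨_, rfl⟩)
  rw [← Finsupp.range_linearCombination, ← Finsupp.range_linearCombination] at this
  exact this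

/-- The Weyl (displacement) operator `W(u)`: the unitary operator on Fock space with
`W(u) ψ(z) = exp(-i Im ⟨u, z⟩) ψ(u + z)` for all `z`; see `weyl_coherent` and `weyl_unique`. -/
def weyl {n : ℕ} (u : Fin n → ℂ) : Fock n ≃ₗᵢ[ℂ] Fock n :=
  (LinearEquiv.refl ℂ ((Fin n → ℂ) →₀ ℂ)).extendOfIsometry
    (Finsupp.linearCombination ℂ coherent) (Finsupp.linearCombination ℂ (displaced u))
    (denseRange_coherent n) (denseRange_displaced u)
    (fun x => linearCombination_norm_eq _ _ (inner_displaced u) x)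

theorem weyl_coherent {n : ℕ} (u z : Fin n → ℂ) :
    weyl u (coherent z) =
      Complex.exp (-Complex.I * ((star u ⬝ᵥ z).im : ℂ)) • coherent (u + z) := by
  have := (LinearEquiv.refl ℂ ((Fin n → ℂ) →₀ ℂ)).extendOfIsometry_eq
    (Finsupp.linearCombination ℂ coherent) (Finsupp.linearCombination ℂ (displaced u))
    (denseRange_coherent n) (denseRange_displaced u)
    (fun x => linearCombination_norm_eq _ _ (inner_displaced u) x) (Finsupp.single z 1)
  simpa [weyl, displaced] using this

theorem weyl_unique {n : ℕ} (u : Fin n → ℂ) (T : Fock n →L[ℂ] Fock n)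
    (hT : ∀ z, T (coherent z) =
      Complex.exp (-Complex.I * ((star u ⬝ᵥ z).im : ℂ)) • coherent (u + z)) (φ : Fock n) :
    T φ = weyl u φ := by
  refine (denseRange_coherent n).induction_on (p := fun φ => T φ = weyl u φ) φ
    (isClosed_eq T.continuous (weyl u).continuous) fun x => ?_
  simp [Finsupp.linearCombination_apply, Finsupp.sum, map_sum, hT, weyl_coherent]

/-! ### States, quantum characteristic function, gaussian states -/

/-- The trace, computed in the particle basis (for trace class operators). -/
def trace {n : ℕ} (T : Fock n →L[ℂ] Fock n) : ℂ :=
  ∑' k : Fin n → ℕ, inner ℂ (particle k) (T (particle k))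

/-- A state: a positive operator which is of trace class (for a positive operator this means that
the diagonal series converges) and has trace `1`. -/
structure IsState {n : ℕ} (ρ : Fock n →L[ℂ] Fock n) : Prop where
  isPositive : ρ.IsPositive
  summable : Summable fun k : Fin n → ℕ => inner ℂ (particle k) (ρ (particle k))
  trace_eq_one : trace ρ = 1

/-- The quantum characteristic function `ρ̂(z) = tr (ρ W(z))`. -/
def quantumChar {n : ℕ} (ρ : Fock n →L[ℂ] Fock n) (z : Fin n → ℂ) : ℂ :=
  trace (ρ ∘L ((weyl z).toContinuousLinearEquiv : Fock n →L[ℂ] Fock n))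

/-- The real column vector `[Re z; Im z]` of length `2n`. -/
def reIm {n : ℕ} (z : Fin n → ℂ) : Fin n ⊕ Fin n → ℝ :=
  Sum.elim (fun j => (z j).re) (fun j => (z j).im)

/-- `ρ` is the gaussian state `ρ_{m,S}` with mean annihilation vector `m` and position-momentum
covariance matrix `S`. -/
structure IsGaussianState {n : ℕ} (ρ : Fock n →L[ℂ] Fock n) (m : Fin n → ℂ)
    (S : Matrix (Fin n ⊕ Fin n) (Fin n ⊕ Fin n) ℝ) : Prop where
  isState : IsState ρ
  isSymm : S.IsSymm
  quantumChar_eq : ∀ z : Fin n → ℂ, quantumChar ρ z =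
    Complex.exp (-2 * Complex.I * ((star z ⬝ᵥ m).im : ℂ) -
      ((reIm z ⬝ᵥ S.mulVec (reIm z) : ℝ) : ℂ))

/-! ### Generating functions and the class `𝓔₂` -/

/-- The generating function `G_Z(u, v) = ⟨e(ū), Z e(v)⟩`. -/
def genFun {n : ℕ} (Z : Fock n →L[ℂ] Fock n) (u v : Fin n → ℂ) : ℂ :=
  inner ℂ (expVec (star u)) (Z (expVec v))

/-- `Z` belongs to `𝓔₂` with parameters `(c, α, β, A, Λ, B)`. -/
structure HasE2Parameters {n : ℕ} (Z : Fock n →L[ℂ] Fock n) (c : ℂ) (α β : Fin n → ℂ)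
    (A Λ B : Matrix (Fin n) (Fin n) ℂ) : Prop where
  isSymm_left : A.IsSymm
  isSymm_right : B.IsSymm
  genFun_eq : ∀ u v : Fin n → ℂ, genFun Z u v =
    c * Complex.exp (u ⬝ᵥ α + β ⬝ᵥ v + u ⬝ᵥ A.mulVec u + u ⬝ᵥ Λ.mulVec v + v ⬝ᵥ B.mulVec v)

/-- `(c, μ, A, Λ)` is the quadruple of `𝓔₂`-parameters of the (positive) operator `ρ`, that is,
`ρ` has the six parameters `(c, μ, μ̄, A, Λ, Ā)`. -/
def HasE2Quadruple {n : ℕ} (ρ : Fock n →L[ℂ] Fock n) (c : ℂ) (μ : Fin n → ℂ)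
    (A Λ : Matrix (Fin n) (Fin n) ℂ) : Prop :=
  HasE2Parameters ρ c μ (star μ) A Λ (A.map star)

/-! ### Matrices -/

/-- `J = [[0, I], [-I, 0]]`. -/
def matJ (n : ℕ) : Matrix (Fin n ⊕ Fin n) (Fin n ⊕ Fin n) ℝ :=
  Matrix.fromBlocks 0 1 (-1) 0

/-- The block row `[I, iI]`. -/
def blockRow (n : ℕ) : Matrix (Fin n) (Fin n ⊕ Fin n) ℂ :=
  Matrix.fromCols 1 (Complex.I • 1)

/-- The block column `[I; iI]`. -/
def blockCol (n : ℕ) : Matrix (Fin n ⊕ Fin n) (Fin n) ℂ :=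
  Matrix.fromRows 1 (Complex.I • 1)

/-- The block column `[I; -iI]`. -/
def blockColConj (n : ℕ) : Matrix (Fin n ⊕ Fin n) (Fin n) ℂ :=
  Matrix.fromRows 1 (-(Complex.I • 1))

/-- `½ I + S`. -/
def halfAdd {n : ℕ} (S : Matrix (Fin n ⊕ Fin n) (Fin n ⊕ Fin n) ℝ) :
    Matrix (Fin n ⊕ Fin n) (Fin n ⊕ Fin n) ℝ :=
  (1 / 2 : ℝ) • (1 : Matrix (Fin n ⊕ Fin n) (Fin n ⊕ Fin n) ℝ) + S

/-- `M(A, Λ) = I - [[Re Λ, -Im Λ], [Im Λ, Re Λ]] - 2 [[Re A, Im A], [Im A, -Re A]]`. -/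
def matM {n : ℕ} (A Λ : Matrix (Fin n) (Fin n) ℂ) :
    Matrix (Fin n ⊕ Fin n) (Fin n ⊕ Fin n) ℝ :=
  1 - Matrix.fromBlocks (Λ.map Complex.re) (-Λ.map Complex.im) (Λ.map Complex.im)
        (Λ.map Complex.re)
    - (2 : ℝ) • Matrix.fromBlocks (A.map Complex.re) (A.map Complex.im) (A.map Complex.im)
        (-A.map Complex.re)

end BosonFock

end

open scoped ComplexOrder
open BosonFock

open scoped ComplexOrder
open BosonFock
open MeasureTheory Matrix

/-! ### Gaussian integrals -/

/-! The Husimi function Q([w]) = ⟨ψ(w), ρψ(w)⟩ links the two descriptions of ρ. Integrating exp(2i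
Im⟨w|z⟩) |ψ(w)⟩⟨ψ(w)| over phase space gives πⁿ exp(-‖z‖²/2) W(z) (`smearsWeyl`). Tracing against ρ
shows that the Fourier transform of Q, read at J[z], is πⁿ exp(-‖z‖²/2) tr ρW(z) (`fourier_husimi`).
For a gaussian state this is a Gaussian whose quadratic form in [z] is ½I + S. Since Q is
integrable, the Riemann–Lebesgue lemma forces ½I + S to be positive definite. Since Q is also
continuous, Fourier inversion makes it a Gaussian centred at [m] with form J(½I + S)⁻¹Jᵀ
(`gaussian_of_fourier`, `husimi_eq`).

The generating function at (w̄, w) equals exp(‖w‖²) Q([w]), and holomorphy extends this to all (u,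
v) (`eq_of_eq_on_antidiagonal`). Matching exponents is then real linear algebra. A real 2n×2n matrix
is the sum of a complex linear and an antilinear map of ℂⁿ; for R = (½I + S)⁻¹ these are I - Λ and
2AC. As J is multiplication by -i, conjugation by J flips only the antilinear part: R = M(-A, Λ),
while Q carries JRJᵀ = M(A, Λ). Expanding the form of Q about m yields μ = (I - Λ - 2AC)m and c
(`matM_quadratic_sub`).

Positivity of ρ on combinations of e(u) and e(0) gives Λ ≥ 0, and comparing exponents along rays
gives uniqueness, so every claim need only be checked for the explicit quadruple. -/

theorem posDef_exists_transpose_mul_self {ι : Type*} [Fintype ι] [DecidableEq ι]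
    {P : Matrix ι ι ℝ} (hP : P.PosDef) : ∃ B : Matrix ι ι ℝ, P = Bᵀ * B ∧ B.det ≠ 0 := by
  open scoped MatrixOrder Matrix.Norms.L2Operator in
  obtain ⟨B, hB⟩ := CStarAlgebra.nonneg_iff_eq_star_mul_self.mp hP.posSemidef.nonneg
  have hB' : P = Bᵀ * B := by
    rw [hB, star_eq_conjTranspose, conjTranspose_eq_transpose_of_trivial]
  refine ⟨B, hB', fun h => hP.det_pos.ne' ?_⟩
  rw [hB', det_mul, h, mul_zero]

/-- The Gaussian integral with a general positive definite form and a purely imaginary linear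
term, together with its integrability. -/
theorem gaussian_integral_posDef {ι : Type*} [Fintype ι] [DecidableEq ι]
    {P : Matrix ι ι ℝ} (hP : P.PosDef) (b : ι → ℝ) :
    Integrable (fun v : ι → ℝ => Complex.exp (-((v ⬝ᵥ P *ᵥ v : ℝ) : ℂ) +
        Complex.I * ((b ⬝ᵥ v : ℝ) : ℂ))) ∧
      ∫ v : ι → ℝ, Complex.exp (-((v ⬝ᵥ P *ᵥ v : ℝ) : ℂ) + Complex.I * ((b ⬝ᵥ v : ℝ) : ℂ)) =
        (Real.pi : ℂ) ^ ((Fintype.card ι : ℂ) / 2) *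
          ((P.det ^ (-(1 / 2) : ℝ) * Real.exp (-(b ⬝ᵥ P⁻¹ *ᵥ b) / 4) : ℝ) : ℂ) := by
  obtain ⟨B, rfl, hB⟩ := posDef_exists_transpose_mul_self hP
  have hBt : IsUnit Bᵀ.det := by rwa [det_transpose, isUnit_iff_ne_zero]
  -- With this c the linear term b·v becomes c·(Bv), so the substitution v ↦ Bv leaves a standard
  -- Gaussian.
  set c : ι → ℝ := (Bᵀ)⁻¹ *ᵥ b with hc
  have hbc : Bᵀ *ᵥ c = b := by
    rw [hc, mulVec_mulVec, mul_nonsing_inv _ hBt, one_mulVec]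
  set f : (ι → ℝ) → ℂ := fun v => Complex.exp (-(1 : ℂ) * ∑ i, (v i : ℂ) ^ 2 +
    ∑ i, (Complex.I * c i) * (v i : ℂ)) with hf
  have hcomp : ∀ v : ι → ℝ, Complex.exp (-((v ⬝ᵥ (Bᵀ * B) *ᵥ v : ℝ) : ℂ) +
      Complex.I * ((b ⬝ᵥ v : ℝ) : ℂ)) = f (Matrix.toLin' B v) := by
    intro v
    have h1 : v ⬝ᵥ (Bᵀ * B) *ᵥ v = (B *ᵥ v) ⬝ᵥ (B *ᵥ v) := by
      rw [← mulVec_mulVec, dotProduct_mulVec, vecMul_transpose]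
    have h2 : b ⬝ᵥ v = c ⬝ᵥ (B *ᵥ v) := by
      rw [← hbc, dotProduct_mulVec, ← mulVec_transpose]
    rw [h1, h2, hf]
    simp only [Matrix.toLin'_apply, dotProduct, Complex.ofReal_sum, Complex.ofReal_mul,
      Finset.mul_sum, sq]
    congr 1
    simp only [neg_one_mul, Finset.sum_neg_distrib, mul_assoc]
  have hfi : Integrable f :=
    GaussianFourier.integrable_cexp_neg_mul_sum_add (b := 1) (by simp) (fun i => Complex.I * c i)
  have hmap := Real.map_matrix_volume_pi_eq_smul_volume_pi (M := B) hB
  have hmeas : Measurable (Matrix.toLin' B) :=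
    (LinearMap.continuous_of_finiteDimensional _).measurable
  have hfi' : Integrable f (Measure.map (Matrix.toLin' B) volume) := by
    rw [hmap]
    exact hfi.smul_measure ENNReal.ofReal_ne_top
  simp only [hcomp]
  refine ⟨hfi'.comp_measurable hmeas, ?_⟩
  rw [← integral_map hmeas.aemeasurable hfi'.1, hmap, integral_smul_measure,
    GaussianFourier.integral_cexp_neg_mul_sum_add (b := 1) (by simp)]
  have h3 : (∑ i, (Complex.I * c i) ^ 2) / (4 * 1) = ((-(b ⬝ᵥ (Bᵀ * B)⁻¹ *ᵥ b) / 4 : ℝ) : ℂ) := by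
    have : b ⬝ᵥ (Bᵀ * B)⁻¹ *ᵥ b = c ⬝ᵥ c := by
      rw [Matrix.mul_inv_rev, ← mulVec_mulVec, ← hc, dotProduct_mulVec, ← mulVec_transpose,
        transpose_nonsing_inv]
    rw [this]
    simp [dotProduct, mul_pow, ← sq]
  -- The right side is the Jacobian factor of the substitution.
  have h4 : (Bᵀ * B).det ^ (-(1 / 2) : ℝ) = |B.det⁻¹| := by
    rw [det_mul, det_transpose, Real.rpow_neg (mul_self_nonneg _), ← Real.sqrt_eq_rpow,
      Real.sqrt_mul_self_eq_abs, abs_inv]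
  rw [h3, h4, div_one, ENNReal.toReal_ofReal (abs_nonneg _), Complex.real_smul]
  push_cast
  ring

/-! ### Fourier inversion in coordinates -/

/-- Fourier analysis needs the Euclidean inner product, which `ι → ℝ` does not carry; `ofLp`
preserves volume, so integrals can be moved freely between the two. -/
theorem integral_ofLp {ι : Type*} [Fintype ι] (f : (ι → ℝ) → ℂ) :
    ∫ v : EuclideanSpace ℝ ι, f v.ofLp = ∫ v, f v :=
  (PiLp.volume_preserving_ofLp ι).integral_comp
    (MeasurableEquiv.toLp 2 (ι → ℝ)).symm.measurableEmbedding f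

theorem integrable_ofLp {ι : Type*} [Fintype ι] (f : (ι → ℝ) → ℂ) :
    Integrable (fun v : EuclideanSpace ℝ ι => f v.ofLp) ↔ Integrable f :=
  (PiLp.volume_preserving_ofLp ι).integrable_comp_emb
    (MeasurableEquiv.toLp 2 (ι → ℝ)).symm.measurableEmbedding

theorem inner_eq_dotProduct {ι : Type*} [Fintype ι] (v w : EuclideanSpace ℝ ι) :
    inner ℝ v w = v.ofLp ⬝ᵥ w.ofLp := by
  rw [EuclideanSpace.inner_eq_star_dotProduct, star_trivial, dotProduct_comm]

theorem fourier_inversion_pi {ι : Type*} [Fintype ι] {f g : (ι → ℝ) → ℂ} (hf : Continuous f)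
    (hfi : Integrable f) (hgi : Integrable g)
    (hg : ∀ t, g t = ∫ v, Complex.exp (((-2 * Real.pi * (v ⬝ᵥ t) : ℝ) : ℂ) * Complex.I) * f v)
    (p : ι → ℝ) :
    f p = ∫ t, Complex.exp (((2 * Real.pi * (t ⬝ᵥ p) : ℝ) : ℂ) * Complex.I) * g t := by
  set f' : EuclideanSpace ℝ ι → ℂ := fun v => f v.ofLp with hf'
  have hF : FourierTransform.fourier f' = fun t : EuclideanSpace ℝ ι => g t.ofLp := by
    funext t
    rw [Real.fourier_eq', hg, ← integral_ofLp]
    simp only [inner_eq_dotProduct, hf', smul_eq_mul]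
  have h := Continuous.fourierInv_fourier_eq (f := f') (hf.comp (PiLp.continuous_ofLp 2 _))
    ((integrable_ofLp f).mpr hfi) (by rw [hF]; exact (integrable_ofLp g).mpr hgi)
  have h2 := congrFun h (WithLp.toLp 2 p)
  rw [hF, Real.fourierInv_eq'] at h2
  rw [← integral_ofLp]
  simpa [inner_eq_dotProduct, hf'] using h2.symm

/-- The Riemann–Lebesgue lemma, since a ray through t ≠ 0 leaves every compact set. For a
nonintegrable f all these integrals are 0 by convention. -/
theorem tendsto_fourier_ray {ι : Type*} [Fintype ι] (f : (ι → ℝ) → ℂ) {t : ι → ℝ} (ht : t ≠ 0) :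
    Filter.Tendsto (fun s : ℝ => ∫ v, Complex.exp (((-2 * Real.pi * (s * (v ⬝ᵥ t)) : ℝ) : ℂ) *
      Complex.I) * f v) Filter.atTop (nhds 0) := by
  have h := tendsto_integral_exp_inner_smul_cocompact
    (fun v : EuclideanSpace ℝ ι => f v.ofLp)
  have ht' : WithLp.toLp 2 t ≠ 0 := by simpa using ht
  have hray : Filter.Tendsto (fun s : ℝ => s • WithLp.toLp 2 t) Filter.atTop
      (Filter.cocompact (EuclideanSpace ℝ ι)) := by
    rw [← Metric.cobounded_eq_cocompact, ← tendsto_norm_atTop_iff_cobounded]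
    simp only [norm_smul]
    exact Filter.tendsto_abs_atTop_atTop.atTop_mul_const (norm_pos_iff.mpr ht')
  refine (h.comp hray).congr fun s => ?_
  rw [← integral_ofLp]
  simp only [Function.comp_def, inner_eq_dotProduct, Circle.smul_def, Real.fourierChar_apply,
    smul_eq_mul]
  refine integral_congr_ae (Filter.Eventually.of_forall fun v => ?_)
  simp only [WithLp.ofLp_smul, dotProduct_smul, smul_eq_mul]
  congr 3
  push_cast
  ring

/-- An integrable continuous function whose Fourier transform is a Gaussian function is a Gaussian
density; in particular the quadratic form in the exponent is positive definite. -/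
theorem gaussian_of_fourier {ι : Type*} [Fintype ι] [DecidableEq ι] {Q : (ι → ℝ) → ℂ}
    (hQ : Continuous Q) (hQi : Integrable Q) {P : Matrix ι ι ℝ} (hP : P.IsSymm) (m : ι → ℝ)
    (h : ∀ t : ι → ℝ, ∫ p, Complex.exp (2 * Complex.I * ((t ⬝ᵥ p : ℝ) : ℂ)) * Q p =
      (Real.pi : ℂ) ^ ((Fintype.card ι : ℂ) / 2) *
        Complex.exp (2 * Complex.I * ((t ⬝ᵥ m : ℝ) : ℂ) - ((t ⬝ᵥ P *ᵥ t : ℝ) : ℂ))) :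
    P.PosDef ∧ ∀ p, Q p =
      ((P.det ^ (-(1 / 2) : ℝ) * Real.exp (-((p - m) ⬝ᵥ P⁻¹ *ᵥ (p - m))) : ℝ) : ℂ) := by
  have hpi : (Real.pi : ℂ) ≠ 0 := by exact_mod_cast Real.pi_ne_zero
  have hF : ∀ t : ι → ℝ, ∫ p, Complex.exp (((-2 * Real.pi * (p ⬝ᵥ t) : ℝ) : ℂ) * Complex.I) * Q p =
      (Real.pi : ℂ) ^ ((Fintype.card ι : ℂ) / 2) * (Complex.exp (-((t ⬝ᵥ (Real.pi ^ 2 • P) *ᵥ t : ℝ) : ℂ)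
        + Complex.I * (((-2 * Real.pi) • m ⬝ᵥ t : ℝ) : ℂ))) := by
    intro t
    -- The rescaling t ↦ -πt turns the kernel exp(2i t·p) into exp(-2πi p·t), at the price of
    -- replacing P by π²P.
    have := h ((-Real.pi) • t)
    convert this using 3
    · congr 2
      rw [dotProduct_comm, smul_dotProduct, smul_eq_mul]
      push_cast
      ring
    · simp only [smul_dotProduct, mulVec_smul, dotProduct_smul, smul_mulVec, smul_eq_mul,
        dotProduct_comm t m]
      push_cast
      ring
  have hPD : P.PosDef := by
    refine PosDef.of_dotProduct_mulVec_pos ?_ fun t ht => ?_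
    · rw [IsHermitian, conjTranspose_eq_transpose_of_trivial]
      exact hP
    rw [star_trivial]
    -- If tᵀPt ≤ 0, the transform stays bounded away from 0 along the ray through t. This excludes
    -- degenerate directions as well as negative ones.
    by_contra hneg
    rw [not_lt] at hneg
    have h1 := (tendsto_fourier_ray Q ht).norm
    rw [norm_zero] at h1
    have h2 : ∀ s : ℝ, ‖(Real.pi : ℂ) ^ ((Fintype.card ι : ℂ) / 2)‖ ≤
        ‖∫ v, Complex.exp (((-2 * Real.pi * (s * (v ⬝ᵥ t)) : ℝ) : ℂ) * Complex.I) * Q v‖ := by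
      intro s
      have h3 := hF (s • t)
      simp only [dotProduct_smul, smul_eq_mul] at h3
      rw [h3, norm_mul]
      refine le_mul_of_one_le_right (norm_nonneg _) ?_
      rw [Complex.norm_exp]
      refine Real.one_le_exp ?_
      simp only [smul_dotProduct, mulVec_smul, dotProduct_smul, smul_mulVec, smul_eq_mul]
      simp only [Complex.add_re, Complex.neg_re, Complex.ofReal_re, Complex.mul_re, Complex.I_re,
        zero_mul, Complex.ofReal_im, mul_zero, sub_zero, add_zero]
      have : s * (Real.pi ^ 2 * (s * (t ⬝ᵥ P *ᵥ t))) = (s * Real.pi) ^ 2 * (t ⬝ᵥ P *ᵥ t) := by ring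
      rw [this]
      linarith [mul_nonpos_of_nonneg_of_nonpos (sq_nonneg (s * Real.pi)) hneg]
    have h4 := ge_of_tendsto' h1 h2
    exact (norm_pos_iff.mpr (Complex.cpow_ne_zero_iff.mpr (Or.inl hpi))).not_ge h4
  refine ⟨hPD, fun p => ?_⟩
  have hPpi : (Real.pi ^ 2 • P).PosDef := hPD.smul (by positivity)
  have hdet : IsUnit P.det := hPD.det_pos.ne'.isUnit
  have key := fourier_inversion_pi hQ hQi
    (((gaussian_integral_posDef hPpi ((-2 * Real.pi) • m)).1).const_mul
      ((Real.pi : ℂ) ^ ((Fintype.card ι : ℂ) / 2))) (fun t => (hF t).symm) p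
  rw [key]
  have hint : ∀ t : ι → ℝ, Complex.exp (((2 * Real.pi * (t ⬝ᵥ p) : ℝ) : ℂ) * Complex.I) *
      ((Real.pi : ℂ) ^ ((Fintype.card ι : ℂ) / 2) *
        (Complex.exp (-((t ⬝ᵥ (Real.pi ^ 2 • P) *ᵥ t : ℝ) : ℂ)
        + Complex.I * (((-2 * Real.pi) • m ⬝ᵥ t : ℝ) : ℂ)))) =
      (Real.pi : ℂ) ^ ((Fintype.card ι : ℂ) / 2) *
        (Complex.exp (-((t ⬝ᵥ (Real.pi ^ 2 • P) *ᵥ t : ℝ) : ℂ)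
        + Complex.I * (((2 * Real.pi) • (p - m) ⬝ᵥ t : ℝ) : ℂ))) := by
    intro t
    rw [mul_left_comm, ← Complex.exp_add]
    congr 2
    simp only [smul_dotProduct, sub_dotProduct, smul_eq_mul, dotProduct_comm t p]
    push_cast
    ring
  simp only [hint]
  rw [integral_const_mul, (gaussian_integral_posDef hPpi _).2, ← mul_assoc, ← Complex.cpow_add _ _ hpi,
    add_halves, Complex.cpow_natCast]
  -- The hypothesis and the Gaussian integral each contribute π to half the dimension; their product
  -- is cancelled by this determinant.
  have hdetpi : (Real.pi ^ 2 • P).det ^ (-(1 / 2) : ℝ) =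
      (Real.pi ^ Fintype.card ι)⁻¹ * P.det ^ (-(1 / 2) : ℝ) := by
    rw [det_smul, Real.mul_rpow (by positivity) hPD.det_pos.le, Real.rpow_neg (by positivity),
      ← Real.sqrt_eq_rpow, pow_right_comm, Real.sqrt_sq (by positivity)]
  have hquad : -((2 * Real.pi) • (p - m) ⬝ᵥ (Real.pi ^ 2 • P)⁻¹ *ᵥ ((2 * Real.pi) • (p - m))) / 4 =
      -((p - m) ⬝ᵥ P⁻¹ *ᵥ (p - m)) := by
    have : (Real.pi ^ 2 • P)⁻¹ = (Real.pi ^ 2)⁻¹ • P⁻¹ := by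
      refine inv_eq_right_inv ?_
      rw [smul_mul_smul_comm, mul_nonsing_inv _ hdet, mul_inv_cancel₀ (by positivity), one_smul]
    rw [this]
    simp only [smul_dotProduct, mulVec_smul, dotProduct_smul, smul_mulVec, smul_eq_mul]
    field_simp
    ring
  rw [hdetpi, hquad]
  push_cast
  field_simp

/-! ### Overlaps with coherent states -/

/-- The kernel ⟨e(z), e(w)⟩ makes the norm of a difference an explicit continuous function. -/
theorem continuous_expVec {n : ℕ} : Continuous (expVec (n := n)) := by
  rw [continuous_iff_continuousAt]
  intro w₀
  rw [ContinuousAt, tendsto_iff_norm_sub_tendsto_zero]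
  have h1 : ∀ w : Fin n → ℂ, ‖expVec w - expVec w₀‖ = Real.sqrt (Complex.exp (star w ⬝ᵥ w) -
      Complex.exp (star w ⬝ᵥ w₀) - (Complex.exp (star w₀ ⬝ᵥ w) - Complex.exp (star w₀ ⬝ᵥ w₀))).re := by
    intro w
    rw [norm_eq_sqrt_re_inner (𝕜 := ℂ)]
    simp only [inner_sub_left, inner_sub_right, inner_expVec]
    congr 1
    simp
    ring
  simp only [h1]
  have h2 : Continuous fun w : Fin n → ℂ => Real.sqrt (Complex.exp (star w ⬝ᵥ w) -
      Complex.exp (star w ⬝ᵥ w₀) - (Complex.exp (star w₀ ⬝ᵥ w) - Complex.exp (star w₀ ⬝ᵥ w₀))).re := by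
    fun_prop
  simpa using h2.tendsto w₀

theorem continuous_coherent {n : ℕ} : Continuous (coherent (n := n)) := by
  have := continuous_expVec (n := n)
  unfold coherent
  fun_prop

/-- The complex vector with given real and imaginary parts; the inverse of `reIm`. -/
def ofReIm {n : ℕ} (p : Fin n ⊕ Fin n → ℝ) : Fin n → ℂ :=
  fun j => (p (Sum.inl j) : ℂ) + Complex.I * (p (Sum.inr j) : ℂ)

theorem reIm_ofReIm {n : ℕ} (p : Fin n ⊕ Fin n → ℝ) : reIm (ofReIm p) = p := by
  funext i
  rcases i with j | j <;> simp [reIm, ofReIm]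

theorem ofReIm_reIm {n : ℕ} (z : Fin n → ℂ) : ofReIm (reIm z) = z := by
  funext j
  apply Complex.ext <;> simp [reIm, ofReIm]

theorem continuous_ofReIm {n : ℕ} : Continuous (ofReIm (n := n)) := by
  unfold ofReIm
  fun_prop

/-- The function `p ↦ ⟨ψ(w), φ⟩`, `[w] = p`, representing the vector `φ` on phase space. -/
noncomputable def overlap {n : ℕ} (φ : Fock n) (p : Fin n ⊕ Fin n → ℝ) : ℂ :=
  inner ℂ (coherent (ofReIm p)) φ

theorem continuous_overlap {n : ℕ} (φ : Fock n) : Continuous (overlap φ) :=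
  (continuous_coherent.comp continuous_ofReIm).inner continuous_const

/-- The character `p ↦ exp (2i tᵀp)`. -/
noncomputable def phase {n : ℕ} (t p : Fin n ⊕ Fin n → ℝ) : ℂ :=
  Complex.exp (2 * Complex.I * ((t ⬝ᵥ p : ℝ) : ℂ))

theorem norm_phase {n : ℕ} (t p : Fin n ⊕ Fin n → ℝ) : ‖phase t p‖ = 1 := by
  rw [phase, show 2 * Complex.I * ((t ⬝ᵥ p : ℝ) : ℂ) = ((2 * (t ⬝ᵥ p) : ℝ) : ℂ) * Complex.I by
    push_cast; ring]
  exact Complex.norm_exp_ofReal_mul_I _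

theorem continuous_phase {n : ℕ} (t : Fin n ⊕ Fin n → ℝ) : Continuous (phase t) := by
  unfold phase
  fun_prop

theorem phase_zero {n : ℕ} (p : Fin n ⊕ Fin n → ℝ) : phase 0 p = 1 := by
  simp [phase]

/-- The exponent on the right is 2i Im⟨w|z⟩, and the imaginary part of the inner product is the
symplectic form of J. -/
theorem phase_matJ {n : ℕ} (z : Fin n → ℂ) (p : Fin n ⊕ Fin n → ℝ) :
    phase (matJ n *ᵥ reIm z) p =
      Complex.exp (star (ofReIm p) ⬝ᵥ z - star z ⬝ᵥ ofReIm p) := by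
  rw [phase]
  congr 1
  have h : matJ n *ᵥ reIm z = Sum.elim (fun j => (z j).im) (fun j => -(z j).re) := by
    rw [matJ, reIm, fromBlocks_mulVec]
    funext i
    rcases i with j | j <;> simp [Function.comp_def, Matrix.neg_mulVec]
  rw [h]
  simp only [dotProduct, Fintype.sum_sum_type, Sum.elim_inl, Sum.elim_inr, Pi.star_apply,
    ← Finset.sum_add_distrib, ← Finset.sum_sub_distrib, Complex.ofReal_sum, Finset.mul_sum]
  refine Finset.sum_congr rfl fun j _ => ?_
  apply Complex.ext <;> simp [ofReIm] <;> ring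

/-- Each complex coordinate splits into two real ones with linear coefficients a + b and i(a - b);
completing squares leaves ((a + b)² - (a - b)²)/4 = ab. -/
theorem gaussian_integral_dotProduct {n : ℕ} (a b : Fin n → ℂ) :
    Integrable (fun p : Fin n ⊕ Fin n → ℝ => Complex.exp (-(star (ofReIm p) ⬝ᵥ ofReIm p) +
        a ⬝ᵥ ofReIm p + star (ofReIm p) ⬝ᵥ b)) ∧
      ∫ p : Fin n ⊕ Fin n → ℝ, Complex.exp (-(star (ofReIm p) ⬝ᵥ ofReIm p) +
        a ⬝ᵥ ofReIm p + star (ofReIm p) ⬝ᵥ b) = (Real.pi : ℂ) ^ n * Complex.exp (a ⬝ᵥ b) := by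
  set c : Fin n ⊕ Fin n → ℂ :=
    Sum.elim (fun j => a j + b j) (fun j => Complex.I * (a j - b j)) with hc
  have h : ∀ p : Fin n ⊕ Fin n → ℝ, -(star (ofReIm p) ⬝ᵥ ofReIm p) + a ⬝ᵥ ofReIm p +
      star (ofReIm p) ⬝ᵥ b = -1 * ∑ i, (p i : ℂ) ^ 2 + ∑ i, c i * (p i : ℂ) := by
    intro p
    simp only [dotProduct, Fintype.sum_sum_type, hc, Sum.elim_inl, Sum.elim_inr, Pi.star_apply,
      ← Finset.sum_add_distrib, ← Finset.sum_neg_distrib, Finset.mul_sum]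
    refine Finset.sum_congr rfl fun j _ => ?_
    simp only [ofReIm, star_add, star_mul', Complex.star_def, Complex.conj_I, Complex.conj_ofReal]
    linear_combination (p (Sum.inr j) : ℂ) ^ 2 * Complex.I_sq
  have h1 : (0 : ℝ) < (1 : ℂ).re := by simp
  simp only [h]
  refine ⟨GaussianFourier.integrable_cexp_neg_mul_sum_add h1 c, ?_⟩
  rw [GaussianFourier.integral_cexp_neg_mul_sum_add h1 c]
  congr 1
  · rw [div_one, Fintype.card_sum, Fintype.card_fin, show ((n + n : ℕ) : ℂ) / 2 = (n : ℂ) by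
      push_cast; ring, Complex.cpow_natCast]
  · congr 1
    simp only [dotProduct, Fintype.sum_sum_type, hc, Sum.elim_inl, Sum.elim_inr,
      ← Finset.sum_add_distrib, Finset.sum_div]
    refine Finset.sum_congr rfl fun j _ => ?_
    linear_combination (a j - b j) ^ 2 / 4 * Complex.I_sq

/-! ### Weyl operators as integrals of coherent projections -/

theorem inner_coherent_expVec {n : ℕ} (w v : Fin n → ℂ) :
    inner ℂ (coherent w) (expVec v) = Complex.exp (-(star w ⬝ᵥ w) / 2 + star w ⬝ᵥ v) := by
  have hw : (starRingEnd ℂ) (star w ⬝ᵥ w) = star w ⬝ᵥ w := star_inner_symm w w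
  rw [coherent, inner_smul_left, inner_expVec, ← Complex.exp_conj, ← Complex.exp_add, map_div₀,
    map_neg, hw, map_ofNat]

theorem weyl_expVec {n : ℕ} (z v : Fin n → ℂ) :
    weyl z (expVec v) = Complex.exp (-(star z ⬝ᵥ z) / 2 - star z ⬝ᵥ v) • expVec (z + v) := by
  have hv : expVec v = Complex.exp ((star v ⬝ᵥ v) / 2) • coherent v := by
    rw [coherent, smul_smul, ← Complex.exp_add]
    ring_nf
    simp
  have hI : Complex.I * ((star z ⬝ᵥ v).im : ℂ) = (star z ⬝ᵥ v - star v ⬝ᵥ z) / 2 := by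
    rw [← star_inner_symm z v]
    apply Complex.ext <;> simp
  rw [hv, map_smul, weyl_coherent, coherent, smul_smul, smul_smul, ← Complex.exp_add,
    ← Complex.exp_add, neg_mul, hI]
  congr 2
  simp only [star_add, add_dotProduct, dotProduct_add]
  ring

/-- The operator identity `∫ exp(2i Im⟨w, z⟩) |ψ(w)⟩⟨ψ(w)| dw = πⁿ exp(-‖z‖²/2) W(z)`, tested on a
pair of vectors. -/
def SmearsWeyl {n : ℕ} (z : Fin n → ℂ) (φ φ' : Fock n) : Prop :=
  Integrable (fun p => star (overlap φ p) * (phase (matJ n *ᵥ reIm z) p * overlap φ' p)) ∧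
    ∫ p, star (overlap φ p) * (phase (matJ n *ᵥ reIm z) p * overlap φ' p) =
      (Real.pi : ℂ) ^ n * Complex.exp (-(star z ⬝ᵥ z) / 2) * inner ℂ φ (weyl z φ')

/-- The phase only shifts the arguments of the Gaussian integrand, to u - z in the conjugated slot
and v + z in the other; shifting is also what W(z) does to exponential vectors. -/
theorem smearsWeyl_expVec {n : ℕ} (z u v : Fin n → ℂ) :
    SmearsWeyl z (expVec u) (expVec v) := by
  have h : ∀ p, star (overlap (expVec u) p) *
      (phase (matJ n *ᵥ reIm z) p * overlap (expVec v) p) =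
      Complex.exp (-(star (ofReIm p) ⬝ᵥ ofReIm p) + star (u - z) ⬝ᵥ ofReIm p +
        star (ofReIm p) ⬝ᵥ (v + z)) := by
    intro p
    have hw : ∀ x y : Fin n → ℂ, (starRingEnd ℂ) (star x ⬝ᵥ y) = star y ⬝ᵥ x := star_inner_symm
    rw [overlap, overlap, inner_coherent_expVec, inner_coherent_expVec, phase_matJ,
      Complex.star_def, ← Complex.exp_conj, ← Complex.exp_add, ← Complex.exp_add]
    congr 1
    simp only [map_add, map_neg, map_div₀, map_ofNat, hw, star_sub, sub_dotProduct,
      dotProduct_add]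
    ring
  unfold SmearsWeyl
  simp only [h]
  refine ⟨(gaussian_integral_dotProduct _ _).1, ?_⟩
  rw [(gaussian_integral_dotProduct _ _).2, weyl_expVec, inner_smul_right, inner_expVec,
    mul_assoc, ← Complex.exp_add, ← Complex.exp_add]
  congr 2
  simp only [star_sub, sub_dotProduct, dotProduct_add]
  ring

theorem overlap_add {n : ℕ} (φ φ' : Fock n) (p : Fin n ⊕ Fin n → ℝ) :
    overlap (φ + φ') p = overlap φ p + overlap φ' p := inner_add_right _ _ _

theorem overlap_smul {n : ℕ} (a : ℂ) (φ : Fock n) (p : Fin n ⊕ Fin n → ℝ) :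
    overlap (a • φ) p = a * overlap φ p := inner_smul_right _ _ _

theorem SmearsWeyl.add_left {n : ℕ} {z : Fin n → ℂ} {φ₁ φ₂ φ' : Fock n}
    (h₁ : SmearsWeyl z φ₁ φ') (h₂ : SmearsWeyl z φ₂ φ') : SmearsWeyl z (φ₁ + φ₂) φ' := by
  unfold SmearsWeyl
  simp only [overlap_add, star_add, add_mul, inner_add_left, mul_add]
  exact ⟨h₁.1.add h₂.1, by rw [integral_add h₁.1 h₂.1, h₁.2, h₂.2]⟩

theorem SmearsWeyl.add_right {n : ℕ} {z : Fin n → ℂ} {φ φ₁ φ₂ : Fock n}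
    (h₁ : SmearsWeyl z φ φ₁) (h₂ : SmearsWeyl z φ φ₂) : SmearsWeyl z φ (φ₁ + φ₂) := by
  unfold SmearsWeyl
  simp only [overlap_add, map_add, inner_add_right, mul_add]
  exact ⟨h₁.1.add h₂.1, by rw [integral_add h₁.1 h₂.1, h₁.2, h₂.2]⟩

theorem SmearsWeyl.smul_left {n : ℕ} {z : Fin n → ℂ} {φ φ' : Fock n} (a : ℂ)
    (h : SmearsWeyl z φ φ') : SmearsWeyl z (a • φ) φ' := by
  unfold SmearsWeyl
  simp only [overlap_smul, star_mul', inner_smul_left, mul_assoc (star a)]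
  exact ⟨h.1.const_mul _, by rw [integral_const_mul, h.2, Complex.star_def]; ring⟩

theorem SmearsWeyl.smul_right {n : ℕ} {z : Fin n → ℂ} {φ φ' : Fock n} (a : ℂ)
    (h : SmearsWeyl z φ φ') : SmearsWeyl z φ (a • φ') := by
  unfold SmearsWeyl
  simp only [overlap_smul, map_smul, inner_smul_right, mul_left_comm _ a]
  exact ⟨h.1.const_mul _, by rw [integral_const_mul, h.2]⟩

theorem smearsWeyl_linearCombination {n : ℕ} (z : Fin n → ℂ) (x y : (Fin n → ℂ) →₀ ℂ) :
    SmearsWeyl z (Finsupp.linearCombination ℂ coherent x)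
      (Finsupp.linearCombination ℂ coherent y) := by
  have h0 : ∀ φ : Fock n, SmearsWeyl z 0 φ := by
    intro φ
    simp [SmearsWeyl, overlap]
  have h0' : ∀ φ : Fock n, SmearsWeyl z φ 0 := by
    intro φ
    simp [SmearsWeyl, overlap]
  induction x using Finsupp.induction_linear with
  | zero => simpa using h0 _
  | add x₁ x₂ h₁ h₂ => rw [map_add]; exact h₁.add_left h₂
  | single u a =>
    rw [Finsupp.linearCombination_single]
    refine SmearsWeyl.smul_left a ?_
    induction y using Finsupp.induction_linear with
    | zero => simpa using h0' _
    | add y₁ y₂ h₁ h₂ => rw [map_add]; exact h₁.add_right h₂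
    | single v b =>
      rw [Finsupp.linearCombination_single]
      exact SmearsWeyl.smul_right b ((SmearsWeyl.smul_left _
        (SmearsWeyl.smul_right _ (smearsWeyl_expVec z u v))))

theorem inner_self_eq_ofReal {n : ℕ} (φ : Fock n) :
    inner ℂ φ φ = ((‖φ‖ ^ 2 : ℝ) : ℂ) := by
  rw [inner_self_eq_norm_sq_to_K]
  simp

theorem weyl_zero {n : ℕ} (φ : Fock n) : weyl 0 φ = φ := by
  refine (weyl_unique 0 (ContinuousLinearMap.id ℂ _) (fun z => ?_) φ).symm
  simp

theorem reIm_zero {n : ℕ} : reIm (0 : Fin n → ℂ) = 0 := by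
  funext i
  rcases i with j | j <;> simp [reIm]

/-- The case z = 0 is the resolution of the identity by coherent states. -/
theorem norm_sq_eq_of_smearsWeyl {n : ℕ} {φ : Fock n} (h : SmearsWeyl 0 φ φ) :
    Integrable (fun p => ‖overlap φ p‖ ^ 2) ∧
      ∫ p, ‖overlap φ p‖ ^ 2 = Real.pi ^ n * ‖φ‖ ^ 2 := by
  have h1 : ∀ p, star (overlap φ p) * (phase (matJ n *ᵥ reIm 0) p * overlap φ p) =
      ((‖overlap φ p‖ ^ 2 : ℝ) : ℂ) := by
    intro p
    rw [reIm_zero, mulVec_zero, phase_zero, one_mul, Complex.star_def, Complex.conj_mul',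
      Complex.ofReal_pow]
  unfold SmearsWeyl at h
  simp only [h1, weyl_zero, inner_self_eq_ofReal] at h
  refine ⟨by simpa only [RCLike.re_to_complex, Complex.ofReal_re] using h.1.re, ?_⟩
  have h2 := h.2
  rw [integral_complex_ofReal] at h2
  simp only [star_zero, zero_dotProduct, neg_zero, zero_div, Complex.exp_zero, mul_one] at h2
  exact_mod_cast h2

theorem eLpNorm_overlap_of_smearsWeyl {n : ℕ} {φ : Fock n} (h : SmearsWeyl 0 φ φ) :
    eLpNorm (overlap φ) 2 volume = ENNReal.ofReal (Real.sqrt (Real.pi ^ n) * ‖φ‖) := by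
  have hm : MemLp (overlap φ) 2 volume :=
    (memLp_two_iff_integrable_sq_norm (continuous_overlap φ).aestronglyMeasurable).mpr
      (norm_sq_eq_of_smearsWeyl h).1
  rw [hm.eLpNorm_eq_integral_rpow_norm (by norm_num) (by norm_num)]
  simp only [ENNReal.toReal_ofNat, Real.rpow_ofNat]
  rw [(norm_sq_eq_of_smearsWeyl h).2, ← one_div, ← Real.sqrt_eq_rpow,
    Real.sqrt_mul (by positivity), Real.sqrt_sq (norm_nonneg _)]

theorem exists_seq_linearCombination_tendsto {n : ℕ} (φ : Fock n) :
    ∃ x : ℕ → (Fin n → ℂ) →₀ ℂ, Filter.Tendsto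
      (fun k => Finsupp.linearCombination ℂ coherent (x k)) Filter.atTop (nhds φ) := by
  obtain ⟨y, hy, hlim⟩ := mem_closure_iff_seq_limit.mp (denseRange_coherent n φ)
  choose x hx using hy
  exact ⟨x, by simpa only [hx] using hlim⟩

/-- Fatou's lemma along combinations of coherent states converging to φ, whose overlaps converge
pointwise. An inequality suffices: it makes `phaseOverlap` bounded. -/
theorem eLpNorm_overlap_le {n : ℕ} (φ : Fock n) :
    eLpNorm (overlap φ) 2 volume ≤ ENNReal.ofReal (Real.sqrt (Real.pi ^ n) * ‖φ‖) := by
  obtain ⟨x, hx⟩ := exists_seq_linearCombination_tendsto φ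
  have h1 := Lp.eLpNorm_lim_le_liminf_eLpNorm (p := 2) (μ := volume)
    (f := fun k => overlap (Finsupp.linearCombination ℂ coherent (x k)))
    (fun k => (continuous_overlap _).aestronglyMeasurable) (overlap φ)
    (Filter.Eventually.of_forall fun p =>
      ((continuous_const.inner continuous_id).tendsto φ).comp hx)
  simp only [eLpNorm_overlap_of_smearsWeyl (smearsWeyl_linearCombination 0 _ _)] at h1
  refine h1.trans (le_of_eq (Filter.Tendsto.liminf_eq ?_))
  exact ENNReal.tendsto_ofReal (hx.norm.const_mul _)

theorem eLpNorm_phase_mul_overlap {n : ℕ} (t : Fin n ⊕ Fin n → ℝ) (φ : Fock n) :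
    eLpNorm (fun p => phase t p * overlap φ p) 2 volume = eLpNorm (overlap φ) 2 volume :=
  eLpNorm_congr_norm_ae (Filter.Eventually.of_forall fun p => by
    rw [norm_mul, norm_phase, one_mul])

theorem memLp_phase_mul_overlap {n : ℕ} (t : Fin n ⊕ Fin n → ℝ) (φ : Fock n) :
    MemLp (fun p => phase t p * overlap φ p) 2 volume := by
  refine ⟨((continuous_phase t).mul (continuous_overlap φ)).aestronglyMeasurable, ?_⟩
  rw [eLpNorm_phase_mul_overlap]
  exact (eLpNorm_overlap_le φ).trans_lt ENNReal.ofReal_lt_top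

/-- The bounded operator `φ ↦ exp(2i tᵀp) ⟨ψ(w), φ⟩` into square integrable functions on phase
space. -/
noncomputable def phaseOverlap {n : ℕ} (t : Fin n ⊕ Fin n → ℝ) :
    Fock n →L[ℂ] Lp ℂ 2 (volume : Measure (Fin n ⊕ Fin n → ℝ)) :=
  LinearMap.mkContinuous
    { toFun := fun φ => (memLp_phase_mul_overlap t φ).toLp
      map_add' := fun φ φ' => by
        rw [← MemLp.toLp_add]
        congr 1
        funext p
        simp only [overlap_add, mul_add, Pi.add_apply]
      map_smul' := fun a φ => by
        rw [RingHom.id_apply, ← MemLp.toLp_const_smul]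
        congr 1
        funext p
        simp only [overlap_smul, Pi.smul_apply, smul_eq_mul, mul_left_comm] }
    (Real.sqrt (Real.pi ^ n)) (fun φ => by
      simp only [LinearMap.coe_mk, AddHom.coe_mk, Lp.norm_toLp, eLpNorm_phase_mul_overlap]
      exact ENNReal.toReal_le_of_le_ofReal (by positivity) (eLpNorm_overlap_le φ))

theorem coeFn_phaseOverlap {n : ℕ} (t : Fin n ⊕ Fin n → ℝ) (φ : Fock n) :
    phaseOverlap t φ =ᵐ[volume] fun p => phase t p * overlap φ p :=
  (memLp_phase_mul_overlap t φ).coeFn_toLp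

theorem inner_phaseOverlap {n : ℕ} (t : Fin n ⊕ Fin n → ℝ) (φ φ' : Fock n) :
    inner ℂ (phaseOverlap 0 φ) (phaseOverlap t φ') =
      ∫ p, star (overlap φ p) * (phase t p * overlap φ' p) := by
  rw [L2.inner_def]
  refine integral_congr_ae ?_
  filter_upwards [coeFn_phaseOverlap 0 φ, coeFn_phaseOverlap t φ'] with p h1 h2
  rw [h1, h2, phase_zero, one_mul, RCLike.inner_apply, mul_comm]
  rfl

/-- Integrability holds because the integrand is a product of two L² functions. Both sides of the
identity are continuous in φ, by boundedness of `phaseOverlap` and of W(z), and agree on the dense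
span of coherent states. -/
theorem smearsWeyl {n : ℕ} (z : Fin n → ℂ) (φ : Fock n) : SmearsWeyl z φ φ := by
  constructor
  · have h := L2.integrable_inner (𝕜 := ℂ) (phaseOverlap 0 φ) (phaseOverlap (matJ n *ᵥ reIm z) φ)
    refine h.congr ?_
    filter_upwards [coeFn_phaseOverlap 0 φ, coeFn_phaseOverlap (matJ n *ᵥ reIm z) φ] with p h1 h2
    rw [h1, h2, phase_zero, one_mul, RCLike.inner_apply, mul_comm]
    rfl
  · rw [← inner_phaseOverlap]
    refine (denseRange_coherent n).induction_on (p := fun φ =>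
      inner ℂ (phaseOverlap 0 φ) (phaseOverlap (matJ n *ᵥ reIm z) φ) =
      (Real.pi : ℂ) ^ n * Complex.exp (-(star z ⬝ᵥ z) / 2) * inner ℂ φ (weyl z φ)) φ
      (isClosed_eq ?_ ?_) fun x => ?_
    · exact (phaseOverlap _).continuous.inner (phaseOverlap _).continuous
    · exact continuous_const.mul (continuous_id.inner (weyl z).continuous)
    · rw [inner_phaseOverlap]
      exact (smearsWeyl_linearCombination z x x).2

/-! ### The Husimi function of a state and its Fourier transform -/

theorem isPositive_exists_adjoint_comp_self {H : Type*} [NormedAddCommGroup H]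
    [InnerProductSpace ℂ H] [CompleteSpace H] {T : H →L[ℂ] H} (hT : T.IsPositive) :
    ∃ B : H →L[ℂ] H, T = ContinuousLinearMap.adjoint B ∘L B :=
  CStarAlgebra.nonneg_iff_eq_star_mul_self.mp
    ((ContinuousLinearMap.nonneg_iff_isPositive T).mpr hT)

theorem inner_particle {n : ℕ} (k : Fin n → ℕ) (φ : Fock n) :
    inner ℂ (particle k) φ = φ k := by
  rw [particle, lp.inner_single_left]
  simp

theorem hasSum_inner_particle {n : ℕ} (φ φ' : Fock n) :
    HasSum (fun k => inner ℂ φ (particle k) * inner ℂ (particle k) φ') (inner ℂ φ φ') := by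
  refine (lp.hasSum_inner (𝕜 := ℂ) φ φ').congr_fun ?_
  intro k
  rw [← inner_conj_symm, inner_particle, inner_particle, RCLike.inner_apply, mul_comm]

theorem hasSum_norm_inner_particle {n : ℕ} (φ : Fock n) :
    HasSum (fun k => ‖inner ℂ (particle k) φ‖ ^ 2) (‖φ‖ ^ 2) := by
  have h := hasSum_inner_particle φ φ
  have h1 : ∀ k, inner ℂ φ (particle k) * inner ℂ (particle k) φ =
      ((‖inner ℂ (particle k) φ‖ ^ 2 : ℝ) : ℂ) := by
    intro k
    rw [← inner_conj_symm, Complex.conj_mul', Complex.ofReal_pow]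
  simp only [h1, inner_self_eq_ofReal] at h
  exact_mod_cast h

/-- A state is a mixture of vector states, uniformly for its expectation values in vectors and its
quantum characteristic function. -/
theorem BosonFock.IsState.exists_decomposition {n : ℕ} {ρ : Fock n →L[ℂ] Fock n} (hρ : IsState ρ) :
    ∃ φ : (Fin n → ℕ) → Fock n, (Summable fun j => ‖φ j‖ ^ 2) ∧
      (∀ x, HasSum (fun j => ((‖inner ℂ x (φ j)‖ ^ 2 : ℝ) : ℂ)) (inner ℂ x (ρ x))) ∧
      ∀ z, HasSum (fun j => inner ℂ (φ j) (weyl z (φ j))) (quantumChar ρ z) := by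
  obtain ⟨B, hB⟩ := isPositive_exists_adjoint_comp_self hρ.isPositive
  have hBin : ∀ x y, inner ℂ x (ρ y) = inner ℂ (B x) (B y) := by
    intro x y
    rw [hB, ContinuousLinearMap.comp_apply, ContinuousLinearMap.adjoint_inner_right]
  -- Inserting the particle basis between the factors of ρ = B*B gives ρ = Σ |φⱼ⟩⟨φⱼ| with φⱼ =
  -- B*|j⟩.
  set φ : (Fin n → ℕ) → Fock n := fun j => ContinuousLinearMap.adjoint B (particle j) with hφ
  have hφB : ∀ j x, inner ℂ (particle j) (B x) = inner ℂ (φ j) x := by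
    intro j x
    rw [hφ, ContinuousLinearMap.adjoint_inner_left]
  have hBsum : Summable fun k : Fin n → ℕ => ‖B (particle k)‖ ^ 2 := by
    have h := hρ.summable
    simp only [hBin, inner_self_eq_ofReal] at h
    exact_mod_cast h
  -- Finite trace means that B is Hilbert–Schmidt: its squared matrix entries are summable over both
  -- indices, hence in either order.
  have hdouble : Summable fun q : (Fin n → ℕ) × (Fin n → ℕ) =>
      ‖inner ℂ (φ q.2) (particle q.1)‖ ^ 2 := by
    refine (summable_prod_of_nonneg fun _ => by positivity).mpr ⟨fun k => ?_, ?_⟩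
    · simp only [← hφB]
      exact (hasSum_norm_inner_particle _).summable
    · simp only [← hφB, (hasSum_norm_inner_particle _).tsum_eq]
      exact hBsum
  have hsymm : ∀ x y : Fock n, ‖inner ℂ x y‖ = ‖inner ℂ y x‖ := fun x y => norm_inner_symm x y
  have hφsum : Summable fun j => ‖φ j‖ ^ 2 := by
    have h := hdouble.prod_symm.prod
    simp only [Prod.swap, hsymm (φ _), (hasSum_norm_inner_particle _).tsum_eq] at h
    exact h
  refine ⟨φ, hφsum, fun x => ?_, fun z => ?_⟩
  · rw [hBin, inner_self_eq_ofReal]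
    simp only [hsymm x, ← hφB]
    exact Complex.hasSum_ofReal.mpr (hasSum_norm_inner_particle (B x))
  · have hW : ∀ j k, inner ℂ (φ j) (weyl z (particle k)) =
        inner ℂ ((weyl z).symm (φ j)) (particle k) := by
      intro j k
      rw [← (weyl z).inner_map_map ((weyl z).symm (φ j)), LinearIsometryEquiv.apply_symm_apply]
    have hdouble' : Summable fun q : (Fin n → ℕ) × (Fin n → ℕ) =>
        ‖inner ℂ ((weyl z).symm (φ q.1)) (particle q.2)‖ ^ 2 := by
      refine (summable_prod_of_nonneg fun _ => by positivity).mpr ⟨fun j => ?_, ?_⟩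
      · simp only [hsymm _ (particle _)]
        exact (hasSum_norm_inner_particle _).summable
      · simp only [hsymm _ (particle _), (hasSum_norm_inner_particle _).tsum_eq,
          LinearIsometryEquiv.norm_map]
        exact hφsum
    have hprod : Summable fun q : (Fin n → ℕ) × (Fin n → ℕ) =>
        inner ℂ ((weyl z).symm (φ q.1)) (particle q.2) * inner ℂ (particle q.2) (φ q.1) := by
      refine Summable.of_norm_bounded (hdouble'.add hdouble.prod_symm) fun q => ?_
      rw [norm_mul, hsymm (particle q.2)]
      simp only [Prod.swap]
      nlinarith [sq_nonneg (‖inner ℂ ((weyl z).symm (φ q.1)) (particle q.2)‖ -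
        ‖inner ℂ (φ q.1) (particle q.2)‖), norm_nonneg (inner ℂ ((weyl z).symm (φ q.1)) (particle q.2)),
        norm_nonneg (inner ℂ (φ q.1) (particle q.2)),
        sq_nonneg ‖inner ℂ ((weyl z).symm (φ q.1)) (particle q.2)‖]
    have hrow : ∀ j, HasSum (fun k => inner ℂ ((weyl z).symm (φ j)) (particle k) *
        inner ℂ (particle k) (φ j)) (inner ℂ (φ j) (weyl z (φ j))) := by
      intro j
      have := hasSum_inner_particle ((weyl z).symm (φ j)) (φ j)
      rwa [← (weyl z).inner_map_map ((weyl z).symm (φ j)),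
        LinearIsometryEquiv.apply_symm_apply] at this
    have hcol : ∀ k, HasSum (fun j => inner ℂ ((weyl z).symm (φ j)) (particle k) *
        inner ℂ (particle k) (φ j)) (inner ℂ (particle k) (ρ (weyl z (particle k)))) := by
      intro k
      rw [hBin]
      refine (hasSum_inner_particle _ _).congr_fun fun j => ?_
      rw [hφB, hW, ← inner_conj_symm (B _), hφB, inner_conj_symm, mul_comm]
    -- One absolutely summable double series: rows give Σ ⟨φⱼ, W(z)φⱼ⟩, columns give the trace of
    -- ρW(z).
    have h1 := hprod.hasSum.prod_fiberwise hrow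
    have h2 := hprod.prod_symm.hasSum.prod_fiberwise hcol
    have h3 : quantumChar ρ z = ∑' q : (Fin n → ℕ) × (Fin n → ℕ),
        inner ℂ ((weyl z).symm (φ q.1)) (particle q.2) * inner ℂ (particle q.2) (φ q.1) := by
      rw [← (Equiv.prodComm _ _).tsum_eq]
      exact h2.tsum_eq
    rw [h3]
    exact h1

/-- The Husimi function `p ↦ ⟨ψ(w), ρ ψ(w)⟩`, `[w] = p`. -/
noncomputable def husimi {n : ℕ} (ρ : Fock n →L[ℂ] Fock n) (p : Fin n ⊕ Fin n → ℝ) : ℂ :=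
  inner ℂ (coherent (ofReIm p)) (ρ (coherent (ofReIm p)))

theorem continuous_husimi {n : ℕ} (ρ : Fock n →L[ℂ] Fock n) : Continuous (husimi ρ) := by
  have h := (continuous_coherent (n := n)).comp continuous_ofReIm
  exact h.inner (ρ.continuous.comp h)

/-- The Fourier transform of the Husimi function is the antinormally ordered quantum
characteristic function. -/
theorem BosonFock.IsState.fourier_husimi {n : ℕ} {ρ : Fock n →L[ℂ] Fock n} (hρ : IsState ρ)
    (z : Fin n → ℂ) :
    ∫ p, phase (matJ n *ᵥ reIm z) p * husimi ρ p =
      (Real.pi : ℂ) ^ n * Complex.exp (-(star z ⬝ᵥ z) / 2) * quantumChar ρ z := by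
  obtain ⟨φ, hφ, hexp, hchar⟩ := hρ.exists_decomposition
  set t := matJ n *ᵥ reIm z with ht
  have hi : ∀ j, Integrable fun p => phase t p * ((‖overlap (φ j) p‖ ^ 2 : ℝ) : ℂ) := by
    intro j
    refine (smearsWeyl z (φ j)).1.congr (Filter.Eventually.of_forall fun p => ?_)
    simp only [Complex.ofReal_pow, ← Complex.conj_mul', Complex.star_def]
    ring
  have hnorm : ∀ j p, ‖phase t p * ((‖overlap (φ j) p‖ ^ 2 : ℝ) : ℂ)‖ = ‖overlap (φ j) p‖ ^ 2 := by
    intro j p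
    rw [norm_mul, norm_phase, one_mul, Complex.norm_real, Real.norm_of_nonneg (by positivity)]
  -- By the resolution of the identity the j-th integral is πⁿ‖φⱼ‖², so sum and integral may be
  -- exchanged.
  have hs : Summable fun j => ∫ p, ‖phase t p * ((‖overlap (φ j) p‖ ^ 2 : ℝ) : ℂ)‖ := by
    simp only [hnorm, (norm_sq_eq_of_smearsWeyl (smearsWeyl 0 _)).2]
    exact hφ.mul_left _
  have hQ : ∀ p, HasSum (fun j => phase t p * ((‖overlap (φ j) p‖ ^ 2 : ℝ) : ℂ))
      (phase t p * husimi ρ p) := fun p => (hexp _).mul_left _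
  have h := hasSum_integral_of_summable_integral_norm hi hs
  simp only [(hQ _).tsum_eq] at h
  refine h.unique ?_
  refine ((hchar z).mul_left _).congr_fun fun j => ?_
  rw [← (smearsWeyl z (φ j)).2]
  refine integral_congr_ae (Filter.Eventually.of_forall fun p => ?_)
  simp only [Complex.ofReal_pow, ← Complex.conj_mul', Complex.star_def]
  ring

/-- Were Q not integrable, its integral would be 0 by convention, whereas `fourier_husimi` at z = 0
gives πⁿ. -/
theorem BosonFock.IsState.integrable_husimi {n : ℕ} {ρ : Fock n →L[ℂ] Fock n} (hρ : IsState ρ) :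
    Integrable (husimi ρ) := by
  by_contra hni
  have h := hρ.fourier_husimi 0
  have h1 : quantumChar ρ 0 = 1 := by
    rw [← hρ.trace_eq_one, quantumChar]
    congr 1
    ext1 φ
    simp [weyl_zero]
  simp only [reIm_zero, mulVec_zero, phase_zero, one_mul, integral_undef hni, h1] at h
  simp only [star_zero, zero_dotProduct, neg_zero, zero_div, Complex.exp_zero, mul_one] at h
  exact pow_ne_zero n (by exact_mod_cast Real.pi_ne_zero) h.symm

/-! ### The Husimi function of a gaussian state -/

theorem matJ_mul_transpose (n : ℕ) : matJ n * (matJ n)ᵀ = 1 := by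
  simp [matJ, fromBlocks_transpose, fromBlocks_multiply]

theorem matJ_transpose_mul (n : ℕ) : (matJ n)ᵀ * matJ n = 1 := by
  simp [matJ, fromBlocks_transpose, fromBlocks_multiply]

theorem matJ_transpose (n : ℕ) : (matJ n)ᵀ = -matJ n := by
  simp [matJ, fromBlocks_transpose, fromBlocks_neg]

theorem matJ_conj_inv {n : ℕ} {P : Matrix (Fin n ⊕ Fin n) (Fin n ⊕ Fin n) ℝ}
    (hP : IsUnit P.det) : (matJ n * P * (matJ n)ᵀ)⁻¹ = matJ n * P⁻¹ * (matJ n)ᵀ := by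
  refine inv_eq_right_inv ?_
  calc matJ n * P * (matJ n)ᵀ * (matJ n * P⁻¹ * (matJ n)ᵀ)
      = matJ n * (P * ((matJ n)ᵀ * matJ n) * P⁻¹) * (matJ n)ᵀ := by simp only [Matrix.mul_assoc]
    _ = 1 := by
      rw [matJ_transpose_mul, Matrix.mul_one, mul_nonsing_inv _ hP, Matrix.mul_one,
        matJ_mul_transpose]

theorem matJ_conj_det {n : ℕ} (P : Matrix (Fin n ⊕ Fin n) (Fin n ⊕ Fin n) ℝ) :
    (matJ n * P * (matJ n)ᵀ).det = P.det := by
  have h : (matJ n).det * (matJ n)ᵀ.det = 1 := by rw [← det_mul, matJ_mul_transpose, det_one]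
  rw [det_mul, det_mul]
  linear_combination P.det * h

theorem star_dotProduct_self_eq {n : ℕ} (z : Fin n → ℂ) :
    star z ⬝ᵥ z = ((reIm z ⬝ᵥ reIm z : ℝ) : ℂ) := by
  simp only [dotProduct, Fintype.sum_sum_type, reIm, Sum.elim_inl, Sum.elim_inr,
    ← Finset.sum_add_distrib, Complex.ofReal_sum, Pi.star_apply]
  refine Finset.sum_congr rfl fun j _ => ?_
  apply Complex.ext <;> simp
  ring

theorem re_star_dotProduct {n : ℕ} (z w : Fin n → ℂ) :
    (star z ⬝ᵥ w).re = reIm z ⬝ᵥ reIm w := by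
  simp only [dotProduct, Fintype.sum_sum_type, reIm, Sum.elim_inl, Sum.elim_inr,
    ← Finset.sum_add_distrib, Complex.re_sum, Pi.star_apply]
  refine Finset.sum_congr rfl fun j _ => ?_
  simp

theorem im_star_dotProduct {n : ℕ} (z w : Fin n → ℂ) :
    (star z ⬝ᵥ w).im = -(matJ n *ᵥ reIm z ⬝ᵥ reIm w) := by
  have h : matJ n *ᵥ reIm z = Sum.elim (fun j => (z j).im) (fun j => -(z j).re) := by
    rw [matJ, reIm, fromBlocks_mulVec]
    funext i
    rcases i with j | j <;> simp [Function.comp_def, Matrix.neg_mulVec]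
  rw [h]
  simp only [dotProduct, Fintype.sum_sum_type, reIm, Sum.elim_inl, Sum.elim_inr,
    ← Finset.sum_add_distrib, ← Finset.sum_neg_distrib, Complex.im_sum, Pi.star_apply]
  refine Finset.sum_congr rfl fun j _ => ?_
  simp

theorem halfAdd_isSymm {n : ℕ} {S : Matrix (Fin n ⊕ Fin n) (Fin n ⊕ Fin n) ℝ} (hS : S.IsSymm) :
    (halfAdd S).IsSymm := by
  unfold halfAdd
  exact (isSymm_one.smul _).add hS

/-- The factor exp(-‖z‖²/2) in `fourier_husimi` supplies the ½I added to S. The Fourier variable is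
t = J[z] with J orthogonal, which accounts for the conjugation by J and leaves the determinant
unchanged. -/
theorem BosonFock.IsGaussianState.husimi_eq {n : ℕ} {ρ : Fock n →L[ℂ] Fock n} {m : Fin n → ℂ}
    {S : Matrix (Fin n ⊕ Fin n) (Fin n ⊕ Fin n) ℝ} (hρ : IsGaussianState ρ m S) :
    (halfAdd S).PosDef ∧ ∀ p, husimi ρ p = (((halfAdd S).det ^ (-(1 / 2) : ℝ) *
      Real.exp (-((p - reIm m) ⬝ᵥ (matJ n * (halfAdd S)⁻¹ * (matJ n)ᵀ) *ᵥ (p - reIm m))) : ℝ) :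
        ℂ) := by
  have hsymm := halfAdd_isSymm hρ.isSymm
  have hsymm' : (matJ n * halfAdd S * (matJ n)ᵀ).IsSymm := by
    rw [IsSymm, transpose_mul, transpose_mul, transpose_transpose, hsymm.eq, Matrix.mul_assoc]
  obtain ⟨hpos, hQ⟩ := gaussian_of_fourier (continuous_husimi ρ) hρ.isState.integrable_husimi
    hsymm' (reIm m) (fun t => by
      obtain ⟨z, rfl⟩ : ∃ z : Fin n → ℂ, t = matJ n *ᵥ reIm z :=
        ⟨ofReIm ((matJ n)ᵀ *ᵥ t), by
          rw [reIm_ofReIm, mulVec_mulVec, matJ_mul_transpose, one_mulVec]⟩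
      have h := hρ.isState.fourier_husimi z
      simp only [phase] at h
      rw [h, hρ.quantumChar_eq, mul_assoc, ← Complex.exp_add]
      congr 1
      · rw [Fintype.card_sum, Fintype.card_fin, show ((n + n : ℕ) : ℂ) / 2 = (n : ℂ) by
          push_cast; ring, Complex.cpow_natCast]
      · congr 1
        have hq : matJ n *ᵥ reIm z ⬝ᵥ (matJ n * halfAdd S * (matJ n)ᵀ) *ᵥ (matJ n *ᵥ reIm z) =
            1 / 2 * (reIm z ⬝ᵥ reIm z) + reIm z ⬝ᵥ S *ᵥ reIm z := by
          rw [mulVec_mulVec, Matrix.mul_assoc, matJ_transpose_mul, Matrix.mul_one, ← mulVec_mulVec,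
            dotProduct_mulVec, ← mulVec_transpose, mulVec_mulVec, matJ_transpose_mul, one_mulVec,
            halfAdd, add_mulVec, dotProduct_add, smul_mulVec, dotProduct_smul, one_mulVec,
            smul_eq_mul]
        rw [hq, star_dotProduct_self_eq, im_star_dotProduct]
        push_cast
        ring)
  have hP : (halfAdd S).PosDef := by
    have h := hpos.conjTranspose_mul_mul_same (B := matJ n) (by
      intro x y hxy
      have := congrArg ((matJ n)ᵀ *ᵥ ·) hxy
      simpa [mulVec_mulVec, matJ_transpose_mul] using this)
    rw [conjTranspose_eq_transpose_of_trivial] at h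
    have e : (matJ n)ᵀ * (matJ n * halfAdd S * (matJ n)ᵀ) * matJ n = halfAdd S := by
      calc (matJ n)ᵀ * (matJ n * halfAdd S * (matJ n)ᵀ) * matJ n
          = ((matJ n)ᵀ * matJ n) * halfAdd S * ((matJ n)ᵀ * matJ n) := by
            simp only [Matrix.mul_assoc]
        _ = halfAdd S := by rw [matJ_transpose_mul, Matrix.one_mul, Matrix.mul_one]
    rwa [e] at h
  refine ⟨hP, fun p => ?_⟩
  rw [hQ, matJ_conj_det, matJ_conj_inv hP.det_pos.ne'.isUnit]

/-! ### Analytic continuation of generating functions -/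

/-- Summability, stronger than square summability, follows by writing rⁱ/√i! as (2r)ⁱ/√i! times 2⁻ⁱ
and bounding the product by the sum of squares. -/
theorem summable_norm_expCoeff {n : ℕ} (r : Fin n → ℂ) : Summable fun k => ‖expCoeff r k‖ := by
  refine (hasSum_pi_prod (fun (j : Fin n) (i : ℕ) =>
    r j ^ i / (Real.sqrt (i.factorial : ℝ) : ℂ)) fun j => ?_).1
  have h1 : Summable fun i : ℕ => (4 * ‖r j‖ ^ 2) ^ i / (i.factorial : ℝ) :=
    Real.summable_pow_div_factorial _
  have h2 : Summable fun i : ℕ => (1 / 4 : ℝ) ^ i :=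
    summable_geometric_of_lt_one (by norm_num) (by norm_num)
  refine Summable.of_nonneg_of_le (fun _ => norm_nonneg _) (fun i => ?_) (h1.add h2)
  set s := Real.sqrt (i.factorial : ℝ) with hs
  have hs0 : 0 < s := Real.sqrt_pos.mpr (by exact_mod_cast Nat.factorial_pos _)
  have hs2 : (i.factorial : ℝ) = s ^ 2 := (Real.sq_sqrt (Nat.cast_nonneg _)).symm
  have h3 : (4 * ‖r j‖ ^ 2) ^ i / (i.factorial : ℝ) = ((2 * ‖r j‖) ^ i / s) ^ 2 := by
    rw [hs2, div_pow, ← pow_mul, mul_comm i 2, pow_mul]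
    congr 2
    ring
  have h4 : (1 / 4 : ℝ) ^ i = ((1 / 2) ^ i) ^ 2 := by
    rw [← pow_mul, mul_comm i 2, pow_mul]
    norm_num
  have h5 : ‖r j ^ i / (s : ℂ)‖ = ((2 * ‖r j‖) ^ i / s) * (1 / 2) ^ i := by
    rw [norm_div, norm_pow, Complex.norm_real, Real.norm_of_nonneg hs0.le, mul_pow, div_pow]
    field_simp
    simp
  rw [h3, h4, h5]
  have h6 : 0 ≤ ((2 * ‖r j‖) ^ i / s) * (1 / 2) ^ i := by positivity
  nlinarith [sq_nonneg ((2 * ‖r j‖) ^ i / s - (1 / 2) ^ i)]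

theorem norm_expCoeff_le {n : ℕ} {v : Fin n → ℂ} {r : Fin n → ℝ} (h : ∀ j, ‖v j‖ ≤ r j)
    (k : Fin n → ℕ) : ‖expCoeff v k‖ ≤ ‖expCoeff (fun j => (r j : ℂ)) k‖ := by
  simp only [expCoeff, norm_prod, norm_div, norm_pow, Complex.norm_real]
  refine Finset.prod_le_prod (fun _ _ => by positivity) fun j _ => ?_
  have := (h j).trans (Real.le_norm_self _)
  gcongr

/-- On a ball of radius R the coefficients are dominated by those at |u₀| + R|u₁|, so the series of
holomorphic terms converges uniformly there. -/
theorem differentiable_tsum_expCoeff {n : ℕ} (u₀ u₁ : Fin n → ℂ) {g : ℂ → (Fin n → ℕ) → ℂ}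
    (hg : ∀ k, Differentiable ℂ fun t => g t k)
    (hb : ∀ R : ℝ, ∃ C : ℝ, ∀ t ∈ Metric.ball (0 : ℂ) R, ∀ k, ‖g t k‖ ≤ C) :
    Differentiable ℂ fun t => ∑' k, expCoeff (u₀ + t • u₁) k * g t k := by
  intro t₀
  set R := ‖t₀‖ + 1 with hR
  have ht₀ : t₀ ∈ Metric.ball (0 : ℂ) R := by simp [hR]
  obtain ⟨C, hC⟩ := hb R
  refine DifferentiableOn.differentiableAt (s := Metric.ball 0 R) ?_
    (Metric.isOpen_ball.mem_nhds ht₀)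
  refine Complex.differentiableOn_tsum_of_summable_norm
    (u := fun k => ‖expCoeff (fun j => ((‖u₀ j‖ + R * ‖u₁ j‖ : ℝ) : ℂ)) k‖ * C)
    ((summable_norm_expCoeff _).mul_right C) (fun k => ?_) Metric.isOpen_ball fun k t ht => ?_
  · have h1 : Differentiable ℂ fun t : ℂ => expCoeff (u₀ + t • u₁) k := by
      unfold expCoeff
      simp only [Pi.add_apply, Pi.smul_apply, smul_eq_mul]
      fun_prop
    exact (h1.mul (hg k)).differentiableOn
  · rw [norm_mul]
    refine mul_le_mul (norm_expCoeff_le (fun j => ?_) k) (hC t ht k) (norm_nonneg _)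
      (norm_nonneg _)
    rw [Pi.add_apply, Pi.smul_apply, smul_eq_mul]
    refine (norm_add_le _ _).trans ?_
    rw [norm_mul]
    have : ‖t‖ ≤ R := by simpa using (Metric.mem_ball.mp ht).le
    gcongr

theorem differentiable_inner_expVec {n : ℕ} (φ : Fock n) (v₀ v₁ : Fin n → ℂ) :
    Differentiable ℂ fun t : ℂ => inner ℂ φ (expVec (v₀ + t • v₁)) := by
  have h : ∀ t : ℂ, inner ℂ φ (expVec (v₀ + t • v₁)) =
      ∑' k, expCoeff (v₀ + t • v₁) k * star (φ k) := by
    intro t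
    rw [lp.inner_eq_tsum]
    rfl
  simp only [h]
  refine differentiable_tsum_expCoeff v₀ v₁ (fun k => differentiable_const _) fun R => ?_
  exact ⟨‖φ‖, fun t _ k => by rw [norm_star]; exact lp.norm_apply_le_norm (by norm_num) φ k⟩

/-- Expanding in the particle basis makes u enter holomorphically. The k-th coordinate of Z e(v) is
⟨Z*|k⟩, e(v)⟩, which is holomorphic by the same series argument, and compactness bounds all
coordinates uniformly. -/
theorem differentiable_genFun {n : ℕ} (Z : Fock n →L[ℂ] Fock n) (u₀ u₁ v₀ v₁ : Fin n → ℂ) :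
    Differentiable ℂ fun t : ℂ => genFun Z (u₀ + t • u₁) (v₀ + t • v₁) := by
  have h : ∀ t : ℂ, genFun Z (u₀ + t • u₁) (v₀ + t • v₁) =
      ∑' k, expCoeff (u₀ + t • u₁) k * Z (expVec (v₀ + t • v₁)) k := by
    intro t
    rw [genFun, lp.inner_eq_tsum]
    refine tsum_congr fun k => ?_
    rw [RCLike.inner_apply, mul_comm]
    congr 1
    change star (expCoeff _ k) = _
    simp [expCoeff]
  simp only [h]
  refine differentiable_tsum_expCoeff u₀ u₁ (fun k => ?_) fun R => ?_
  · simp only [← inner_particle, ← ContinuousLinearMap.adjoint_inner_left Z]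
    exact differentiable_inner_expVec _ _ _
  · have hc : Continuous fun t : ℂ => Z (expVec (v₀ + t • v₁)) :=
      Z.continuous.comp (continuous_expVec.comp (by fun_prop))
    obtain ⟨C, hC⟩ := (isCompact_closedBall (0 : ℂ) R).exists_bound_of_continuousOn
      hc.continuousOn
    exact ⟨C, fun t ht k => (lp.norm_apply_le_norm (by norm_num) _ k).trans
      (hC t (Metric.ball_subset_closedBall ht))⟩

theorem eq_of_eq_on_real {f g : ℂ → ℂ} (hf : Differentiable ℂ f) (hg : Differentiable ℂ g)
    (h : ∀ t : ℝ, f t = g t) : f = g := by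
  refine AnalyticOnNhd.eq_of_frequently_eq (z₀ := 0)
    (fun z _ => hf.analyticAt z) (fun z _ => hg.analyticAt z) ?_
  have h1 : Filter.Tendsto (fun t : ℝ => (t : ℂ)) (nhdsWithin 0 {0}ᶜ) (nhdsWithin 0 {0}ᶜ) := by
    refine tendsto_nhdsWithin_iff.mpr ⟨?_, ?_⟩
    · exact (Complex.continuous_ofReal.tendsto' 0 0 Complex.ofReal_zero).mono_left
        nhdsWithin_le_nhds
    · filter_upwards [self_mem_nhdsWithin] with t ht
      simpa using ht
  exact h1.frequently (Filter.Frequently.of_forall h)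

/-- Polarization: two functions that are holomorphic along complex lines agree if they agree on
the antidiagonal `u = w̄`, `v = w`. -/
theorem eq_of_eq_on_antidiagonal {n : ℕ} {F G : (Fin n → ℂ) → (Fin n → ℂ) → ℂ}
    (hF : ∀ u₀ u₁ v₀ v₁, Differentiable ℂ fun t : ℂ => F (u₀ + t • u₁) (v₀ + t • v₁))
    (hG : ∀ u₀ u₁ v₀ v₁, Differentiable ℂ fun t : ℂ => G (u₀ + t • u₁) (v₀ + t • v₁))
    (h : ∀ w, F (star w) w = G (star w) w) (u v : Fin n → ℂ) : F u v = G u v := by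
  -- The line (w̄₀ + t w̄₁, w₀ + t w₁) lies in the antidiagonal for real t and passes through (u, v)
  -- at t = i; the identity theorem carries equality from real t to t = i.
  set w₀ : Fin n → ℂ := (1 / 2 : ℂ) • (v + star u) with hw₀
  set w₁ : Fin n → ℂ := (-Complex.I / 2) • (v - star u) with hw₁
  have key := congrFun (eq_of_eq_on_real (hF (star w₀) (star w₁) w₀ w₁)
    (hG (star w₀) (star w₁) w₀ w₁) fun t => by
      have e : star w₀ + (t : ℂ) • star w₁ = star (w₀ + (t : ℂ) • w₁) := by
        rw [star_add, star_smul]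
        congr 2
        simp
      rw [e]
      exact h _) Complex.I
  have hu : star w₀ + Complex.I • star w₁ = u := by
    funext j
    simp only [hw₀, hw₁, Pi.add_apply, Pi.smul_apply, Pi.star_apply, Pi.sub_apply, smul_eq_mul,
      star_mul', star_add, star_sub, Complex.star_def, map_div₀, map_neg,
      Complex.conj_I, map_one, map_ofNat, Complex.conj_conj]
    linear_combination ((starRingEnd ℂ) (v j) - u j) / 2 * Complex.I_sq
  have hv : w₀ + Complex.I • w₁ = v := by
    funext j
    simp only [hw₀, hw₁, Pi.add_apply, Pi.smul_apply, Pi.star_apply, Pi.sub_apply, smul_eq_mul]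
    linear_combination (-(v j - star (u j)) / 2) * Complex.I_sq
  simpa only [hu, hv] using key

/-! ### Uniqueness of the parameters -/

/-- Logarithmic derivatives avoid the 2πi ambiguity of the exponents. -/
theorem coeff_eq_of_exp_quadratic_eq {a b a' b' : ℂ}
    (h : ∀ t : ℂ, Complex.exp (t * a + t ^ 2 * b) = Complex.exp (t * a' + t ^ 2 * b')) :
    a = a' ∧ b = b' := by
  have hd : ∀ x y t : ℂ, HasDerivAt (fun t : ℂ => Complex.exp (t * x + t ^ 2 * y))
      (Complex.exp (t * x + t ^ 2 * y) * (x + 2 * t * y)) t := by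
    intro x y t
    refine HasDerivAt.cexp ?_
    simpa using ((hasDerivAt_id' t).mul_const x).fun_add ((hasDerivAt_pow 2 t).mul_const y)
  have h1 : ∀ t : ℂ, a + 2 * t * b = a' + 2 * t * b' := by
    intro t
    have h2 := hd a b t
    rw [funext h, h t] at h2
    exact mul_left_cancel₀ (Complex.exp_ne_zero _) (h2.unique (hd a' b' t))
  have h0 := h1 0
  simp only [mul_zero, zero_mul, add_zero] at h0
  refine ⟨h0, ?_⟩
  linear_combination (h1 1 - h0) / 2

theorem ext_of_bilinear_eq {n : ℕ} {A B : Matrix (Fin n) (Fin n) ℂ}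
    (h : ∀ u v, u ⬝ᵥ A *ᵥ v = u ⬝ᵥ B *ᵥ v) : A = B := by
  ext i j
  simpa using h (Pi.single i 1) (Pi.single j 1)

theorem ext_of_quadratic_eq {n : ℕ} {A B : Matrix (Fin n) (Fin n) ℂ} (hA : A.IsSymm)
    (hB : B.IsSymm) (h : ∀ u, u ⬝ᵥ A *ᵥ u = u ⬝ᵥ B *ᵥ u) : A = B := by
  have hs : ∀ {C : Matrix (Fin n) (Fin n) ℂ}, C.IsSymm → ∀ u v, v ⬝ᵥ C *ᵥ u = u ⬝ᵥ C *ᵥ v := by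
    intro C hC u v
    rw [dotProduct_mulVec, ← mulVec_transpose, hC.eq, dotProduct_comm]
  refine ext_of_bilinear_eq fun u v => ?_
  have huv := h (u + v)
  simp only [mulVec_add, add_dotProduct, dotProduct_add, hs hA u v, hs hB u v, h u, h v] at huv
  linear_combination huv / 2

/-- The value at (0, 0) gives c. Scaling (u, v) by t separates linear from quadratic terms; v = 0
then isolates μ and A, and Λ is what remains. If c were 0 the other parameters would be arbitrary.
-/
theorem BosonFock.HasE2Quadruple.unique {n : ℕ} {Z : Fock n →L[ℂ] Fock n} {c c' : ℂ}
    {μ μ' : Fin n → ℂ} {A A' Λ Λ' : Matrix (Fin n) (Fin n) ℂ} (h : HasE2Quadruple Z c μ A Λ)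
    (h' : HasE2Quadruple Z c' μ' A' Λ') (hc : c ≠ 0) :
    c' = c ∧ μ' = μ ∧ A' = A ∧ Λ' = Λ := by
  have hcc : c = c' := by
    have := (h.genFun_eq 0 0).symm.trans (h'.genFun_eq 0 0)
    simpa using this
  have key : ∀ u v : Fin n → ℂ, u ⬝ᵥ μ + star μ ⬝ᵥ v = u ⬝ᵥ μ' + star μ' ⬝ᵥ v ∧
      u ⬝ᵥ A *ᵥ u + u ⬝ᵥ Λ *ᵥ v + v ⬝ᵥ A.map star *ᵥ v =
        u ⬝ᵥ A' *ᵥ u + u ⬝ᵥ Λ' *ᵥ v + v ⬝ᵥ A'.map star *ᵥ v := by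
    intro u v
    refine coeff_eq_of_exp_quadratic_eq fun t => ?_
    have h1 := (h.genFun_eq (t • u) (t • v)).symm.trans (h'.genFun_eq (t • u) (t • v))
    rw [← hcc] at h1
    have h2 := mul_left_cancel₀ hc h1
    simp only [smul_dotProduct, mulVec_smul, dotProduct_smul, smul_eq_mul] at h2
    convert h2 using 2 <;> ring
  have hμ : μ = μ' := by
    refine dotProduct_eq _ _ fun u => ?_
    have := (key u 0).1
    simpa [dotProduct_comm] using this
  have hA : A = A' := by
    refine ext_of_quadratic_eq h.isSymm_left h'.isSymm_left fun u => ?_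
    simpa using (key u 0).2
  refine ⟨hcc.symm, hμ.symm, hA.symm, (ext_of_bilinear_eq fun u v => ?_).symm⟩
  have := (key u v).2
  rw [hA] at this
  simpa using this

/-! ### Matrix identities -/

/-- The signs of the two blocks are those of a complex linear and an antilinear map, so M(A, Λ) is
the real matrix of I - Λ - 2AC. -/
theorem matM_mulVec_reIm {n : ℕ} (A Λ : Matrix (Fin n) (Fin n) ℂ) (z : Fin n → ℂ) :
    matM A Λ *ᵥ reIm z = reIm (z - Λ *ᵥ z - (2 : ℂ) • A *ᵥ star z) := by
  rw [matM, sub_mulVec, sub_mulVec, one_mulVec, smul_mulVec, reIm, reIm, fromBlocks_mulVec,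
    fromBlocks_mulVec]
  funext i
  rcases i with j | j
  · simp [Function.comp_def, mulVec, dotProduct, Finset.sum_sub_distrib, Finset.sum_add_distrib,
      Complex.re_sum]
    ring
  · simp [Function.comp_def, mulVec, dotProduct, Finset.sum_sub_distrib, Finset.sum_add_distrib,
      Complex.im_sum]
    ring

theorem reIm_injective {n : ℕ} : Function.Injective (reIm (n := n)) := fun z w h => by
  rw [← ofReIm_reIm z, h, ofReIm_reIm]

/-- The matrix `¼ [I, iI] R [I; iI]`. -/
noncomputable def holoPart {n : ℕ} (R : Matrix (Fin n ⊕ Fin n) (Fin n ⊕ Fin n) ℝ) :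
    Matrix (Fin n) (Fin n) ℂ :=
  (1 / 4 : ℂ) • (blockRow n * R.map Complex.ofReal * blockCol n)

/-- The matrix `I - ½ [I, iI] R [I; -iI]`. -/
noncomputable def mixedPart {n : ℕ} (R : Matrix (Fin n ⊕ Fin n) (Fin n ⊕ Fin n) ℝ) :
    Matrix (Fin n) (Fin n) ℂ :=
  1 - (1 / 2 : ℂ) • (blockRow n * R.map Complex.ofReal * blockColConj n)

theorem holoPart_apply {n : ℕ} (R : Matrix (Fin n ⊕ Fin n) (Fin n ⊕ Fin n) ℝ) (i j : Fin n) :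
    holoPart R i j = 1 / 4 * ((R (.inl i) (.inl j) - R (.inr i) (.inr j) : ℝ) +
      Complex.I * (R (.inr i) (.inl j) + R (.inl i) (.inr j) : ℝ)) := by
  obtain ⟨a, b, c, d, rfl⟩ : ∃ a b c d, R = fromBlocks a b c d :=
    ⟨_, _, _, _, (fromBlocks_toBlocks R).symm⟩
  rw [holoPart, blockRow, blockCol, fromBlocks_map, fromCols_mul_fromBlocks, fromCols_mul_fromRows]
  simp
  linear_combination (d i j : ℂ) * Complex.I_sq

theorem mixedPart_apply {n : ℕ} (R : Matrix (Fin n ⊕ Fin n) (Fin n ⊕ Fin n) ℝ) (i j : Fin n) :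
    mixedPart R i j = (1 : Matrix (Fin n) (Fin n) ℂ) i j -
      1 / 2 * ((R (.inl i) (.inl j) + R (.inr i) (.inr j) : ℝ) +
      Complex.I * (R (.inr i) (.inl j) - R (.inl i) (.inr j) : ℝ)) := by
  obtain ⟨a, b, c, d, rfl⟩ : ∃ a b c d, R = fromBlocks a b c d :=
    ⟨_, _, _, _, (fromBlocks_toBlocks R).symm⟩
  rw [mixedPart, blockRow, blockColConj, fromBlocks_map, fromCols_mul_fromBlocks,
    fromCols_mul_fromRows]
  simp
  linear_combination (-1 / 2 * (d i j : ℂ)) * Complex.I_sq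

theorem holoPart_isSymm {n : ℕ} {R : Matrix (Fin n ⊕ Fin n) (Fin n ⊕ Fin n) ℝ} (hR : R.IsSymm) :
    (holoPart R).IsSymm := by
  ext i j
  rw [transpose_apply, holoPart_apply, holoPart_apply, hR.apply (.inl i), hR.apply (.inr i),
    hR.apply (.inl i), hR.apply (.inr i)]
  push_cast
  ring

theorem mixedPart_isHermitian {n : ℕ} {R : Matrix (Fin n ⊕ Fin n) (Fin n ⊕ Fin n) ℝ}
    (hR : R.IsSymm) : (mixedPart R).IsHermitian := by
  ext i j
  rw [conjTranspose_apply, mixedPart_apply, mixedPart_apply, hR.apply (.inl i), hR.apply (.inr i),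
    hR.apply (.inl i), hR.apply (.inr i), star_sub, ← conjTranspose_apply, conjTranspose_one]
  congr 1
  simp
  ring

/-- Any real matrix R is recovered from its complex linear part I - `mixedPart R` and its antilinear
part 2 `holoPart R` C. -/
theorem matM_neg_holoPart {n : ℕ} (R : Matrix (Fin n ⊕ Fin n) (Fin n ⊕ Fin n) ℝ) :
    matM (-holoPart R) (mixedPart R) = R := by
  ext i j
  rw [matM]
  rcases i with i | i <;> rcases j with j | j <;>
    simp [holoPart_apply, mixedPart_apply, one_apply, apply_ite Complex.re,
      apply_ite Complex.im] <;>
    ring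

/-- J is multiplication by -i, so it commutes with the complex linear part and anticommutes with the
antilinear one. -/
theorem matM_holoPart {n : ℕ} (R : Matrix (Fin n ⊕ Fin n) (Fin n ⊕ Fin n) ℝ) :
    matM (holoPart R) (mixedPart R) = matJ n * R * (matJ n)ᵀ := by
  have hJ : matJ n * R * (matJ n)ᵀ =
      fromBlocks R.toBlocks₂₂ (-R.toBlocks₂₁) (-R.toBlocks₁₂) R.toBlocks₁₁ := by
    conv_lhs => rw [← fromBlocks_toBlocks R]
    simp [matJ, fromBlocks_transpose, fromBlocks_multiply]
  ext i j
  rw [hJ, matM]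
  rcases i with i | i <;> rcases j with j | j <;>
    simp [holoPart_apply, mixedPart_apply, one_apply, apply_ite Complex.re,
      apply_ite Complex.im, toBlocks₁₁, toBlocks₁₂, toBlocks₂₁, toBlocks₂₂] <;>
    ring

theorem blockRow_mulVec {n : ℕ} (p : Fin n ⊕ Fin n → ℝ) :
    blockRow n *ᵥ (fun i => ((p i : ℝ) : ℂ)) = ofReIm p := by
  rw [blockRow, fromCols_mulVec]
  funext j
  simp [ofReIm, smul_mulVec, Function.comp_def]

theorem ofReIm_matJ_mulVec {n : ℕ} (p : Fin n ⊕ Fin n → ℝ) :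
    ofReIm (matJ n *ᵥ p) = -(Complex.I • ofReIm p) := by
  rw [matJ, fromBlocks_mulVec]
  funext j
  simp [ofReIm, Function.comp_def, Matrix.neg_mulVec]
  linear_combination (p (.inr j) : ℂ) * Complex.I_sq

theorem ofReIm_neg {n : ℕ} (p : Fin n ⊕ Fin n → ℝ) : ofReIm (-p) = -ofReIm p := by
  funext j
  simp [ofReIm]
  ring

/-- Reconciles the two formulas for μ: the block row reassembles a complex vector, and the factor i
is the action of Jᵀ = -J on the left. -/
theorem blockRow_mul_matJ_mulVec {n : ℕ} (R : Matrix (Fin n ⊕ Fin n) (Fin n ⊕ Fin n) ℝ)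
    (m : Fin n → ℂ) :
    Complex.I • (blockRow n * (R * matJ n).map Complex.ofReal) *ᵥ
        (fun i => ((reIm m i : ℝ) : ℂ)) =
      m - mixedPart R *ᵥ m - (2 : ℂ) • holoPart R *ᵥ star m := by
  apply reIm_injective
  rw [← matM_mulVec_reIm, matM_holoPart, ← mulVec_mulVec]
  have h : (R * matJ n).map Complex.ofReal *ᵥ (fun i => ((reIm m i : ℝ) : ℂ)) =
      fun i => (((R * matJ n) *ᵥ reIm m) i : ℂ) := by
    funext i
    simp [mulVec, dotProduct]
  have h2 : matJ n * R * (matJ n)ᵀ = matJ n * -(R * matJ n) := by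
    rw [matJ_transpose, Matrix.mul_neg, Matrix.mul_neg, Matrix.mul_assoc]
  rw [h, blockRow_mulVec, h2, ← mulVec_mulVec _ (matJ n) (-(R * matJ n)), neg_mulVec,
    ← reIm_ofReIm (matJ n *ᵥ -((R * matJ n) *ᵥ reIm m)), ofReIm_matJ_mulVec, ofReIm_neg, smul_neg,
    neg_neg]

theorem star_dotProduct_mulVec_conj {n : ℕ} {Λ : Matrix (Fin n) (Fin n) ℂ} (hΛ : Λ.IsHermitian)
    (x y : Fin n → ℂ) : star (Λ *ᵥ x) ⬝ᵥ y = star x ⬝ᵥ Λ *ᵥ y := by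
  rw [star_mulVec, hΛ.eq, dotProduct_mulVec]

theorem star_mulVec_star_dotProduct {n : ℕ} (A : Matrix (Fin n) (Fin n) ℂ)
    (hA : A.IsSymm) (x y : Fin n → ℂ) : star (A *ᵥ star x) ⬝ᵥ y = x ⬝ᵥ A.map star *ᵥ y := by
  rw [star_mulVec, star_star, dotProduct_mulVec, conjTranspose, hA.eq]

theorem dotProduct_mulVec_comm_of_isSymm {n : ℕ} {A : Matrix (Fin n) (Fin n) ℂ} (hA : A.IsSymm)
    (x y : Fin n → ℂ) : x ⬝ᵥ A *ᵥ y = y ⬝ᵥ A *ᵥ x := by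
  rw [dotProduct_mulVec, ← mulVec_transpose, hA.eq, dotProduct_comm]

/-- The real quadratic form of `M(A, Λ)` in complex coordinates. -/
theorem matM_quadratic {n : ℕ} {A Λ : Matrix (Fin n) (Fin n) ℂ} (hA : A.IsSymm)
    (hΛ : Λ.IsHermitian) (x : Fin n → ℂ) :
    ((reIm x ⬝ᵥ matM A Λ *ᵥ reIm x : ℝ) : ℂ) = star x ⬝ᵥ x - star x ⬝ᵥ Λ *ᵥ x -
      star x ⬝ᵥ A *ᵥ star x - x ⬝ᵥ A.map star *ᵥ x := by
  rw [matM_mulVec_reIm, ← re_star_dotProduct]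
  have hre : ∀ a : ℂ, ((a.re : ℝ) : ℂ) = (a + star a) / 2 := fun a => by
    apply Complex.ext <;> simp
  rw [hre, star_inner_symm]
  simp only [star_sub, star_smul, sub_dotProduct, smul_dotProduct, dotProduct_sub, dotProduct_smul,
    star_dotProduct_mulVec_conj hΛ, star_mulVec_star_dotProduct A hA, smul_eq_mul,
    Complex.star_def, map_ofNat]
  ring

/-- The I inside M(A, Λ) cancels ‖w‖², and the cross terms of the shifted form are the pairings of w
with M(A, Λ)[m]; what is left is an 𝓔₂ exponent. -/
theorem matM_quadratic_sub {n : ℕ} {A Λ : Matrix (Fin n) (Fin n) ℂ} (hA : A.IsSymm)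
    (hΛ : Λ.IsHermitian) (w m : Fin n → ℂ) :
    star w ⬝ᵥ w - ((reIm (w - m) ⬝ᵥ matM A Λ *ᵥ reIm (w - m) : ℝ) : ℂ) =
      -((reIm m ⬝ᵥ matM A Λ *ᵥ reIm m : ℝ) : ℂ) +
      (star w ⬝ᵥ (m - Λ *ᵥ m - (2 : ℂ) • A *ᵥ star m) +
        star (m - Λ *ᵥ m - (2 : ℂ) • A *ᵥ star m) ⬝ᵥ w +
        star w ⬝ᵥ A *ᵥ star w + star w ⬝ᵥ Λ *ᵥ w + w ⬝ᵥ A.map star *ᵥ w) := by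
  have hA' : (A.map star).IsSymm := by rw [IsSymm, ← transpose_map, hA.eq]
  rw [matM_quadratic hA hΛ, matM_quadratic hA hΛ]
  simp only [star_sub, star_smul, sub_dotProduct, smul_dotProduct, dotProduct_sub, dotProduct_smul,
    mulVec_sub, star_dotProduct_mulVec_conj hΛ, star_mulVec_star_dotProduct A hA, smul_eq_mul,
    star_ofNat, dotProduct_mulVec_comm_of_isSymm hA (star m) (star w)]
  rw [dotProduct_mulVec_comm_of_isSymm hA' m w]
  ring

/-! ### From the Husimi function to the parameters -/

theorem reIm_sub {n : ℕ} (z w : Fin n → ℂ) : reIm (z - w) = reIm z - reIm w := by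
  funext i
  rcases i with j | j <;> simp [reIm]

theorem genFun_star_eq_husimi {n : ℕ} (ρ : Fock n →L[ℂ] Fock n) (w : Fin n → ℂ) :
    genFun ρ (star w) w = Complex.exp (star w ⬝ᵥ w) * husimi ρ (reIm w) := by
  have hw : (starRingEnd ℂ) (star w ⬝ᵥ w) = star w ⬝ᵥ w := star_inner_symm w w
  rw [husimi, ofReIm_reIm, coherent, map_smul, inner_smul_left, inner_smul_right,
    ← Complex.exp_conj, ← mul_assoc, ← mul_assoc, ← Complex.exp_add, ← Complex.exp_add, map_div₀,
    map_neg, hw, map_ofNat, genFun, star_star]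
  ring_nf
  simp

theorem differentiable_exp_quadratic {n : ℕ} (c : ℂ) (α β : Fin n → ℂ)
    (A Λ B : Matrix (Fin n) (Fin n) ℂ) (u₀ u₁ v₀ v₁ : Fin n → ℂ) :
    Differentiable ℂ fun t : ℂ => c * Complex.exp ((u₀ + t • u₁) ⬝ᵥ α + β ⬝ᵥ (v₀ + t • v₁) +
      (u₀ + t • u₁) ⬝ᵥ A *ᵥ (u₀ + t • u₁) + (u₀ + t • u₁) ⬝ᵥ Λ *ᵥ (v₀ + t • v₁) +
      (v₀ + t • v₁) ⬝ᵥ B *ᵥ (v₀ + t • v₁)) := by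
  simp only [dotProduct, mulVec, Pi.add_apply, Pi.smul_apply, smul_eq_mul]
  fun_prop

/-- The parameters of a gaussian state. -/
theorem BosonFock.IsGaussianState.hasE2Quadruple {n : ℕ} {ρ : Fock n →L[ℂ] Fock n} {m : Fin n → ℂ}
    {S : Matrix (Fin n ⊕ Fin n) (Fin n ⊕ Fin n) ℝ} (hρ : IsGaussianState ρ m S) :
    HasE2Quadruple ρ
      (((halfAdd S).det ^ (-(1 / 2) : ℝ) *
        Real.exp (reIm m ⬝ᵥ (matJ n * (halfAdd S)⁻¹ * matJ n) *ᵥ (reIm m)) : ℝ) : ℂ)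
      (m - mixedPart (halfAdd S)⁻¹ *ᵥ m - (2 : ℂ) • holoPart (halfAdd S)⁻¹ *ᵥ star m)
      (holoPart (halfAdd S)⁻¹) (mixedPart (halfAdd S)⁻¹) := by
  have hR : ((halfAdd S)⁻¹).IsSymm := by
    rw [IsSymm, transpose_nonsing_inv, (halfAdd_isSymm hρ.isSymm).eq]
  have hA := holoPart_isSymm hR
  have hΛ := mixedPart_isHermitian hR
  refine ⟨hA, by rw [IsSymm, ← transpose_map, hA.eq], ?_⟩
  refine eq_of_eq_on_antidiagonal (differentiable_genFun ρ)
    (fun u₀ u₁ v₀ v₁ => differentiable_exp_quadratic _ _ _ _ _ _ u₀ u₁ v₀ v₁) fun w => ?_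
  -- Since Jᵀ = -J, the exponent of c is minus the form of M(A, Λ) at [m], the constant left by
  -- `matM_quadratic_sub`.
  have hK : matJ n * (halfAdd S)⁻¹ * matJ n =
      -matM (holoPart (halfAdd S)⁻¹) (mixedPart (halfAdd S)⁻¹) := by
    rw [matM_holoPart, matJ_transpose, Matrix.mul_neg, neg_neg]
  rw [genFun_star_eq_husimi, hρ.husimi_eq.2, ← matM_holoPart, hK, ← reIm_sub]
  push_cast
  rw [mul_left_comm, mul_assoc, ← Complex.exp_add, ← Complex.exp_add, neg_mulVec, dotProduct_neg,
    Complex.ofReal_neg, ← matM_quadratic_sub hA hΛ, ← sub_eq_add_neg]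

/-- Positivity of the mixed part of the exponent of the generating function. -/
theorem BosonFock.HasE2Quadruple.posSemidef {n : ℕ} {ρ : Fock n →L[ℂ] Fock n} {c : ℝ}
    {μ : Fin n → ℂ} {A Λ : Matrix (Fin n) (Fin n) ℂ} (h : HasE2Quadruple ρ c μ A Λ)
    (hρ : ρ.IsPositive) (hc : 0 < c) (hΛ : Λ.IsHermitian) : Λ.PosSemidef := by
  refine PosSemidef.of_dotProduct_mulVec_nonneg hΛ fun u => ?_
  obtain ⟨r, hr⟩ : ∃ r : ℝ, star u ⬝ᵥ Λ *ᵥ u = (r : ℂ) := by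
    refine ⟨_, (Complex.conj_eq_iff_re.mp ?_).symm⟩
    have := star_inner_symm u (Λ *ᵥ u)
    rwa [star_dotProduct_mulVec_conj hΛ] at this
  set s := star μ ⬝ᵥ u + u ⬝ᵥ A.map star *ᵥ u with hs
  have hs' : star s = star u ⬝ᵥ μ + star u ⬝ᵥ A *ᵥ star u := by
    have h1 := star_mulVec_star_dotProduct A h.isSymm_left u u
    rw [hs, star_add, star_inner_symm, ← h1, star_inner_symm]
  have hG : ∀ x y, inner ℂ (expVec x) (ρ (expVec y)) = genFun ρ (star x) y := fun x y => by
    rw [genFun, star_star]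
  -- The factor exp(-s) removes the terms in μ and A: the diagonal term of e(u) becomes c exp(r)
  -- with r = u*Λu, and both cross terms become -c. The total c(exp(r) - 1) ≥ 0 forces r ≥ 0.
  have hpos := hρ.inner_nonneg_right (Complex.exp (-s) • expVec u - expVec 0)
  have hval : inner ℂ (Complex.exp (-s) • expVec u - expVec 0)
      (ρ (Complex.exp (-s) • expVec u - expVec 0)) = ((c * (Real.exp r - 1) : ℝ) : ℂ) := by
    have e1 : star u ⬝ᵥ μ + star μ ⬝ᵥ u + star u ⬝ᵥ A *ᵥ star u + star u ⬝ᵥ Λ *ᵥ u +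
        u ⬝ᵥ A.map star *ᵥ u = star s + s + r := by rw [hs', hs, hr]; ring
    simp only [map_sub, map_smul, inner_sub_left, inner_sub_right, inner_smul_left,
      inner_smul_right, hG, h.genFun_eq, e1]
    simp only [star_zero, zero_dotProduct, dotProduct_zero, mulVec_zero, add_zero, zero_add,
      ← hs, ← hs', Complex.exp_zero, mul_one, ← Complex.exp_conj, map_neg, ← Complex.star_def]
    simp only [Complex.exp_add, Complex.exp_neg]
    have n1 := Complex.exp_ne_zero s
    have n2 := Complex.exp_ne_zero (star s)
    push_cast
    field_simp
    ring
  rw [hval, Complex.zero_le_real] at hpos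
  rw [hr, Complex.zero_le_real]
  have := nonneg_of_mul_nonneg_right hpos hc
  exact Real.one_le_exp_iff.mp (by linarith)

theorem mainTheorem12 (n : ℕ) (ρ : Fock n →L[ℂ] Fock n) (m : Fin n → ℂ)
    (S : Matrix (Fin n ⊕ Fin n) (Fin n ⊕ Fin n) ℝ) (hρ : IsGaussianState ρ m S) :
    (halfAdd S).PosDef ∧
    (∃ (c : ℂ) (μ : Fin n → ℂ) (A Λ : Matrix (Fin n) (Fin n) ℂ), HasE2Quadruple ρ c μ A Λ) ∧
    ∀ (c : ℂ) (μ : Fin n → ℂ) (A Λ : Matrix (Fin n) (Fin n) ℂ), HasE2Quadruple ρ c μ A Λ →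
      -- the parameters in terms of `m` and `S`
      (c = ((((halfAdd S).det ^ (-(1 / 2) : ℝ) *
              Real.exp (reIm m ⬝ᵥ (matJ n * (halfAdd S)⁻¹ * matJ n).mulVec (reIm m)) : ℝ)) : ℂ) ∧
        μ = Complex.I • (blockRow n * ((halfAdd S)⁻¹ * matJ n).map Complex.ofReal).mulVec
              (fun i => ((reIm m i : ℝ) : ℂ)) ∧
        A = (1 / 4 : ℂ) •
              (blockRow n * ((halfAdd S)⁻¹).map Complex.ofReal * blockCol n) ∧
        Λ = 1 - (1 / 2 : ℂ) •
              (blockRow n * ((halfAdd S)⁻¹).map Complex.ofReal * blockColConj n) ∧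
        Λ.PosSemidef) ∧
      -- the converse relations
      (halfAdd S)⁻¹ = matM (-A) Λ ∧
      m - Λ.mulVec m - (2 : ℂ) • A.mulVec (star m) = μ ∧
      IsUnit (matM A Λ).det ∧
      reIm m = (matM A Λ)⁻¹.mulVec (reIm μ) ∧
      (μ = 0 ↔ m = 0) := by
  have hP := hρ.husimi_eq.1
  have hE := hρ.hasE2Quadruple
  have hc : (0 : ℝ) < (halfAdd S).det ^ (-(1 / 2) : ℝ) *
      Real.exp (reIm m ⬝ᵥ (matJ n * (halfAdd S)⁻¹ * matJ n) *ᵥ (reIm m)) :=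
    mul_pos (Real.rpow_pos_of_pos hP.det_pos _) (Real.exp_pos _)
  refine ⟨hP, ⟨_, _, _, _, hE⟩, fun c μ A Λ h => ?_⟩
  -- As c ≠ 0, an arbitrary quadruple is the explicit one, for which all relations are matrix
  -- identities apart from positivity of Λ.
  obtain ⟨rfl, rfl, rfl, rfl⟩ := hE.unique h (Complex.ofReal_ne_zero.mpr hc.ne')
  have hR : ((halfAdd S)⁻¹).IsSymm := by
    rw [IsSymm, transpose_nonsing_inv, (halfAdd_isSymm hρ.isSymm).eq]
  have hdet : IsUnit (matM (holoPart (halfAdd S)⁻¹) (mixedPart (halfAdd S)⁻¹)).det := by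
    rw [matM_holoPart, matJ_conj_det, det_nonsing_inv]
    exact hP.det_pos.ne'.isUnit.ringInverse
  have hm : reIm m = (matM (holoPart (halfAdd S)⁻¹) (mixedPart (halfAdd S)⁻¹))⁻¹ *ᵥ
      reIm (m - mixedPart (halfAdd S)⁻¹ *ᵥ m - (2 : ℂ) • holoPart (halfAdd S)⁻¹ *ᵥ star m) := by
    rw [← matM_mulVec_reIm, mulVec_mulVec, nonsing_inv_mul _ hdet, one_mulVec]
  refine ⟨⟨rfl, (blockRow_mul_matJ_mulVec _ m).symm, rfl, rfl,
    hE.posSemidef hρ.isState.isPositive hc (mixedPart_isHermitian hR)⟩,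
    (matM_neg_holoPart _).symm, rfl, hdet, hm, fun h0 => ?_, ?_⟩
  · rw [h0, reIm_zero, mulVec_zero] at hm
    exact reIm_injective (hm.trans reIm_zero.symm)
  · rintro rfl
    simp
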